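/- **Setting.** Let $d\ge 0$ and consider Bosons or Fermions on the lattice $\mathbb Z^d$. Put $\zeta=+1$ for Bosons and $\zeta=-1$ for Fermions. Let $\mathcal A$ be the CCR (Bose) or CAR (Fermi) algebra over $\ell^2(\mathbb Z^d)$: the $*$-algebra generated by $1$, $a^*(u)$, $a(u)$, $u\in\ell^2(\mathbb Z^d)$, with $a^*$ linear, $a(u)^*=a^*(u)$, $a(u)a(v)=\zeta a(v)a(u)$ and $a(u)a^*(v)-\zeta a^*(v)a(u)=\langle u,v\rangle$. Write $a^{\#}(x)=a^{\#}(\delta_x)$ for $x\in\mathbb Z^d$. *Dynamics.* Let $h:\mathbb R^d\times\mathbb Z^d\to\mathbb C$ satisfy $h(r,-v)=\overline{h(r,v)}$ and $\sum_v|h(r,v)|<\infty$ for every $r$, and suppose that $E(r,k)=\sum_{v}e^{-ik\cdot v}h(r,v)$ is continuously differentiable in $(r,k)$. For $\varepsilon>0$ let $h_\varepsilon$ be a bounded self-adjoint operator on $\ell^2(\mathbb Z^d)$ with kernel $h_\varepsilon(x,y)=h(\varepsilon\frac{x+y}2,x-y)$ (it exists, for instance, if $\sup_x\sum_y|h_\varepsilon(x,y)|<\infty$),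 and let $\alpha^\varepsilon_t$ be the quasi-free evolution $a^{\#}(u)\mapsto a^{\#}(e^{ith_\varepsilon}u)$. Suppose that Hamilton's equations $\partial_t r=\partial_kE(r,k)$, $\partial_t k=-\partial_rE(r,k)$ have a global solution $(r(x,k;t),k(x,k;t))$ with initial value $(x,k)$, continuous in $(x,k)$ for each $t$. *Convergence of the position operator.* Let $X_j$ be the position operators on $\ell^2(\mathbb Z^d)$ and $r^\varepsilon_j(t)=\varepsilon\,e^{i(t/\varepsilon)h_\varepsilon}X_je^{-i(t/\varepsilon)h_\varepsilon}$. Let $T_a$, $a\in\mathbb Z^d$, be the translations of $\ell^2(\mathbb Z^d)$, $(T_au)(n)=u(n-a)$, let $B=[-\pi,\pi]^d$, and let $\lfloor\cdot\rfloor$ denote the integral part in each coordinate. Assume that there is a dense subspace $\mathcal D\subset\ell^2(\mathbb Z^d)$ such that, for all $u\in\mathcal D$, $t\in\mathbb R$, $x\in\mathbb R^d$ and $1\le j\le d$, the vector $T_{\lfloor x/\varepsilon\rfloor}u$ lies in the domain of $r^\varepsilon_j(t)$ for all small $\varepsilon>0$, and $$\lim_{\varepsilon\downarrow0}\big\|\,r^\varepsilon_j(t)\,T_{\lfloor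 x/\varepsilon\rfloor}u-T_{\lfloor x/\varepsilon\rfloor}\,r_j(x,\cdot\,;t)u\,\big\|=0,$$ where $r_j(x,\cdot\,;t)$ acts on $\ell^2(\mathbb Z^d)$ as multiplication by $r_j(x,k;t)$ in the wave vector variable $k\in B$. *States.* For each $\varepsilon>0$ let $\omega_\varepsilon$ be a gauge-invariant quasi-free state on $\mathcal A$: a normalized positive functional with $\omega_\varepsilon[a^*(u)a(v)]=\langle v,\gamma_\varepsilon u\rangle$ for some bounded operator $\gamma_\varepsilon$ on $\ell^2(\mathbb Z^d)$, whose correlations $\omega_\varepsilon[a^*(u_1)\cdots a^*(u_n)a(v_m)\cdots a(v_1)]$ vanish for $n\ne m$ and equal the permanent (Bose) or the determinant (Fermi) of $(\omega_\varepsilon[a^*(u_i)a(v_j)])_{i,j}$ for $n=m$. Write $\omega_{\varepsilon,t}=\omega_\varepsilon\circ\alpha^\varepsilon_t$. Assume clustering: for every $t$ there is a summable $g$ on $\mathbb Z^d$ such that, for all small $\varepsilon>0$, $|\omega_{\varepsilon,t/\varepsilon}[a^*(x+\eta)a(x)]|\le g(\eta)$ for all $x,\eta\in\mathbb Z^d$.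 Assume that the distribution function $$f^\varepsilon(r,k;t)=(2\pi)^{-d}\sum_{\eta\in\mathbb Z^d}e^{i\eta\cdot k}\,\omega_{\varepsilon,t/\varepsilon}\big[a^*(\lfloor\tfrac r\varepsilon+\tfrac\eta2\rfloor)\,a(\lfloor\tfrac r\varepsilon-\tfrac\eta2\rfloor)\big]$$ converges pointwise, $f^\varepsilon(r,k;t)\to f(r,k;t)\in\mathbb R$ as $\varepsilon\downarrow0$, for all $t\in\mathbb R$, $r\in\mathbb R^d$, $k\in B$. *Fluctuation field.* For $\psi\in C_c^\infty(\mathbb R^d)$ (complex-valued) put $$\xi^\varepsilon(\psi,t)=\varepsilon^{d/2}\sum_{x\in\mathbb Z^d}\psi(\varepsilon x)\Big(\alpha^\varepsilon_{t/\varepsilon}(a^*(x)a(x))-\omega_\varepsilon[\alpha^\varepsilon_{t/\varepsilon}(a^*(x)a(x))]\Big)$$ and $$(e^{ir(t)}\psi)(x,k)=(2\pi)^{-d/2}\int_{\mathbb R^d}dq\,\tilde\psi(q)\,e^{iq\cdot r(x,k;t)},\qquad \tilde\psi(q)=(2\pi)^{-d/2}\int_{\mathbb R^d}dx\,\psi(x)e^{-iq\cdot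 x}.$$ **Proposition.** Under these assumptions, for all $\psi,\phi\in C_c^\infty(\mathbb R^d)$ and all $t,s\in\mathbb R$, the integrand on the right is integrable and $$\lim_{\varepsilon\downarrow0}\omega_\varepsilon[\xi^\varepsilon(\psi,t)\,\xi^\varepsilon(\phi,s)]=\int_{\mathbb R^d\times B}dx\,dk\,(e^{ir(t-s)}\psi)(x,k)\,\phi(x)\,f(x,k;s)\,\big(1+\zeta(2\pi)^df(x,k;s)\big),$$ so that the last factor is $1-(2\pi)^df$ for Fermi and $1+(2\pi)^df$ for Bose statistics. -/

import Mathlib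

open Filter Topology MeasureTheory
open scoped InnerProductSpace

noncomputable section

namespace QuasiFree

/-! ### Canonical (anti)commutation relations -/

/-- Bose or Fermi statistics. -/
inductive Statistics where
  | bose
  | fermi

/-- The sign `ζ`: `+1` for bosons and `-1` for fermions. -/
def Statistics.sign : Statistics → ℂ
  | .bose => 1
  | .fermi => -1

/-- Symbols generating the field algebra: `a*(f)` and `a(f)`, for `f` in the one-particle space. -/
inductive Symbol (H : Type*) where
  | cre (f : H)
  | ann (f : H)

/-- The adjoint of a generating symbol. -/
def Symbol.adj {H : Type*} : Symbol H → Symbol H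
  | .cre f => .ann f
  | .ann f => .cre f

section Algebra

variable (σ : Statistics) (H : Type*) [NormedAddCommGroup H] [InnerProductSpace ℂ H]

/-- The defining relations: `a*` is linear, `a` is antilinear, and
`a*(f)a*(g) = ζ a*(g)a*(f)`, `a(f)a(g) = ζ a(g)a(f)`, `a(f)a*(g) = ζ a*(g)a(f) + ⟨f,g⟩`. -/
inductive FieldRel : FreeAlgebra ℂ (Symbol H) → FreeAlgebra ℂ (Symbol H) → Prop
  | cre_add (f g : H) : FieldRel (FreeAlgebra.ι ℂ (.cre (f + g)))
      (FreeAlgebra.ι ℂ (.cre f) + FreeAlgebra.ι ℂ (.cre g))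
  | cre_smul (c : ℂ) (f : H) : FieldRel (FreeAlgebra.ι ℂ (.cre (c • f)))
      (c • FreeAlgebra.ι ℂ (.cre f))
  | ann_add (f g : H) : FieldRel (FreeAlgebra.ι ℂ (.ann (f + g)))
      (FreeAlgebra.ι ℂ (.ann f) + FreeAlgebra.ι ℂ (.ann g))
  | ann_smul (c : ℂ) (f : H) : FieldRel (FreeAlgebra.ι ℂ (.ann (c • f)))
      (starRingEnd ℂ c • FreeAlgebra.ι ℂ (.ann f))
  | cre_cre (f g : H) : FieldRel (FreeAlgebra.ι ℂ (.cre f) * FreeAlgebra.ι ℂ (.cre g))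
      (σ.sign • (FreeAlgebra.ι ℂ (.cre g) * FreeAlgebra.ι ℂ (.cre f)))
  | ann_ann (f g : H) : FieldRel (FreeAlgebra.ι ℂ (.ann f) * FreeAlgebra.ι ℂ (.ann g))
      (σ.sign • (FreeAlgebra.ι ℂ (.ann g) * FreeAlgebra.ι ℂ (.ann f)))
  | ann_cre (f g : H) : FieldRel (FreeAlgebra.ι ℂ (.ann f) * FreeAlgebra.ι ℂ (.cre g))
      (σ.sign • (FreeAlgebra.ι ℂ (.cre g) * FreeAlgebra.ι ℂ (.ann f))
        + algebraMap ℂ (FreeAlgebra ℂ (Symbol H)) ⟪f, g⟫_ℂ)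

/-- The CCR (Bose) or CAR (Fermi) algebra over the one-particle space `H`: the complex algebra
generated by the identity and all `a*(f)`, `a(f)` subject to the canonical relations. -/
def FieldAlgebra : Type _ := RingQuot (FieldRel σ H)

instance : Ring (FieldAlgebra σ H) := inferInstanceAs (Ring (RingQuot (FieldRel σ H)))
instance : Algebra ℂ (FieldAlgebra σ H) := inferInstanceAs (Algebra ℂ (RingQuot (FieldRel σ H)))

variable {H}

/-- The quotient map onto the field algebra. -/
def mkField : FreeAlgebra ℂ (Symbol H) →ₐ[ℂ] FieldAlgebra σ H :=
  RingQuot.mkAlgHom ℂ (FieldRel σ H)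

theorem mkField_surjective : Function.Surjective (mkField (H := H) σ) :=
  RingQuot.mkAlgHom_surjective ℂ (FieldRel σ H)

/-- The class of a generator in the field algebra. -/
def gen (s : Symbol H) : FieldAlgebra σ H := mkField σ (FreeAlgebra.ι ℂ s)

/-- The creation operator `a*(f)`. -/
def cre (f : H) : FieldAlgebra σ H := gen σ (.cre f)

/-- The annihilation operator `a(f)`. -/
def ann (f : H) : FieldAlgebra σ H := gen σ (.ann f)

theorem cre_add (f g : H) : cre σ (f + g) = cre σ f + cre σ g := by
  have h := RingQuot.mkAlgHom_rel ℂ (FieldRel.cre_add (σ := σ) f g)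
  rw [map_add] at h
  exact h

theorem cre_smul (c : ℂ) (f : H) : cre σ (c • f) = c • cre σ f := by
  have h := RingQuot.mkAlgHom_rel ℂ (FieldRel.cre_smul (σ := σ) c f)
  rw [map_smul] at h
  exact h

theorem ann_add (f g : H) : ann σ (f + g) = ann σ f + ann σ g := by
  have h := RingQuot.mkAlgHom_rel ℂ (FieldRel.ann_add (σ := σ) f g)
  rw [map_add] at h
  exact h

theorem ann_smul (c : ℂ) (f : H) : ann σ (c • f) = starRingEnd ℂ c • ann σ f := by
  have h := RingQuot.mkAlgHom_rel ℂ (FieldRel.ann_smul (σ := σ) c f)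
  rw [map_smul] at h
  exact h

theorem cre_cre (f g : H) : cre σ f * cre σ g = σ.sign • (cre σ g * cre σ f) := by
  have h := RingQuot.mkAlgHom_rel ℂ (FieldRel.cre_cre (σ := σ) f g)
  rw [map_smul, map_mul, map_mul] at h
  exact h

theorem ann_ann (f g : H) : ann σ f * ann σ g = σ.sign • (ann σ g * ann σ f) := by
  have h := RingQuot.mkAlgHom_rel ℂ (FieldRel.ann_ann (σ := σ) f g)
  rw [map_smul, map_mul, map_mul] at h
  exact h

theorem ann_cre (f g : H) : ann σ f * cre σ g =
    σ.sign • (cre σ g * ann σ f) + algebraMap ℂ (FieldAlgebra σ H) ⟪f, g⟫_ℂ := by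
  have h := RingQuot.mkAlgHom_rel ℂ (FieldRel.ann_cre (σ := σ) f g)
  rw [map_add, map_smul, map_mul, map_mul, AlgHom.commutes] at h
  exact h

theorem sign_conj : starRingEnd ℂ σ.sign = σ.sign := by
  cases σ <;> simp [Statistics.sign]

/-- The antilinear antihomomorphism exchanging `a*(f)` and `a(f)`, on the free algebra. -/
def freeAdj : FreeAlgebra ℂ (Symbol H) →+* (FieldAlgebra σ H)ᵐᵒᵖ :=
  letI : Algebra ℂ (FieldAlgebra σ H)ᵐᵒᵖ :=
    Algebra.compHom (FieldAlgebra σ H)ᵐᵒᵖ (starRingEnd ℂ)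
  (FreeAlgebra.lift ℂ (fun s : Symbol H => MulOpposite.op (gen σ s.adj))).toRingHom

theorem freeAdj_ι (s : Symbol H) :
    freeAdj σ (FreeAlgebra.ι ℂ s) = MulOpposite.op (gen σ s.adj) := by
  let _ : Algebra ℂ (FieldAlgebra σ H)ᵐᵒᵖ :=
    Algebra.compHom (FieldAlgebra σ H)ᵐᵒᵖ (starRingEnd ℂ)
  exact FreeAlgebra.lift_ι_apply (R := ℂ)
    (fun s : Symbol H => MulOpposite.op (gen σ s.adj)) s

theorem freeAdj_algebraMap (c : ℂ) :
    freeAdj σ (algebraMap ℂ (FreeAlgebra ℂ (Symbol H)) c) =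
      MulOpposite.op (algebraMap ℂ (FieldAlgebra σ H) (starRingEnd ℂ c)) := by
  let _ : Algebra ℂ (FieldAlgebra σ H)ᵐᵒᵖ :=
    Algebra.compHom (FieldAlgebra σ H)ᵐᵒᵖ (starRingEnd ℂ)
  exact AlgHom.commutes
    (FreeAlgebra.lift ℂ (fun s : Symbol H => MulOpposite.op (gen σ s.adj))) c

theorem freeAdj_smul (c : ℂ) (x : FreeAlgebra ℂ (Symbol H)) :
    freeAdj σ (c • x) = starRingEnd ℂ c • freeAdj σ x := by
  rw [Algebra.smul_def, map_mul, freeAdj_algebraMap]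
  apply MulOpposite.unop_injective
  rw [MulOpposite.unop_mul, MulOpposite.unop_op, MulOpposite.unop_smul, Algebra.smul_def,
    Algebra.commutes]

theorem freeAdj_rel {x y : FreeAlgebra ℂ (Symbol H)} (h : FieldRel σ H x y) :
    freeAdj σ x = freeAdj σ y := by
  apply MulOpposite.unop_injective
  cases h <;>
    simp only [map_add, map_mul, freeAdj_smul, freeAdj_ι, freeAdj_algebraMap, sign_conj,
      MulOpposite.unop_add, MulOpposite.unop_mul, MulOpposite.unop_smul, MulOpposite.unop_op,
      Symbol.adj, Complex.conj_conj, inner_conj_symm]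
  · exact ann_add σ _ _
  · exact ann_smul σ _ _
  · exact cre_add σ _ _
  · exact cre_smul σ _ _
  · exact ann_ann σ _ _
  · exact cre_cre σ _ _
  · exact ann_cre σ _ _

/-- The adjoint on the field algebra, as a ring homomorphism to the opposite algebra. -/
def adjHom : FieldAlgebra σ H →+* (FieldAlgebra σ H)ᵐᵒᵖ :=
  RingQuot.lift ⟨freeAdj σ, fun _ _ h => freeAdj_rel σ h⟩

theorem adjHom_mk (x : FreeAlgebra ℂ (Symbol H)) : adjHom σ (mkField σ x) = freeAdj σ x := by
  have h := RingQuot.lift_mkRingHom_apply (freeAdj σ) (fun _ _ h => freeAdj_rel σ h) x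
  rw [← RingQuot.mkAlgHom_coe ℂ] at h
  exact h

theorem adjHom_gen (s : Symbol H) : adjHom σ (gen σ s) = MulOpposite.op (gen σ s.adj) := by
  rw [gen, adjHom_mk, freeAdj_ι]

theorem adjHom_smul (c : ℂ) (x : FieldAlgebra σ H) :
    adjHom σ (c • x) = starRingEnd ℂ c • adjHom σ x := by
  obtain ⟨y, rfl⟩ := mkField_surjective σ x
  rw [← map_smul, adjHom_mk, adjHom_mk, freeAdj_smul]

theorem adjHom_adjHom (x : FieldAlgebra σ H) :
    (adjHom σ (adjHom σ x).unop).unop = x := by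
  obtain ⟨y, rfl⟩ := mkField_surjective σ x
  induction y using FreeAlgebra.induction with
  | grade0 r =>
    rw [AlgHom.commutes, Algebra.algebraMap_eq_smul_one, adjHom_smul, map_one,
      MulOpposite.unop_smul, MulOpposite.unop_one, adjHom_smul, map_one,
      MulOpposite.unop_smul, MulOpposite.unop_one, Complex.conj_conj]
  | grade1 s =>
    have h3 : s.adj.adj = s := by cases s <;> rfl
    change (adjHom σ (adjHom σ (gen σ s)).unop).unop = gen σ s
    rw [adjHom_gen, MulOpposite.unop_op, adjHom_gen, MulOpposite.unop_op, h3]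
  | mul a b ha hb => simp only [map_mul, MulOpposite.unop_mul, ha, hb]
  | add a b ha hb => simp only [map_add, MulOpposite.unop_add, ha, hb]

/-- The field algebra is a complex star algebra with `a(f)* = a*(f)`. -/
instance : StarRing (FieldAlgebra σ H) where
  star x := (adjHom σ x).unop
  star_involutive := adjHom_adjHom σ
  star_mul x y := by simp only [map_mul, MulOpposite.unop_mul]
  star_add x y := by simp only [map_add, MulOpposite.unop_add]

instance : StarModule ℂ (FieldAlgebra σ H) where
  star_smul c x := congrArg MulOpposite.unop (adjHom_smul σ c x)

theorem star_ann (f : H) : star (ann σ f) = cre σ f :=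
  congrArg MulOpposite.unop (adjHom_gen σ (.ann f))

theorem star_cre (f : H) : star (cre σ f) = ann σ f :=
  congrArg MulOpposite.unop (adjHom_gen σ (.cre f))

/-- The action of a one-particle isometry on a generating symbol. -/
def Symbol.map (U : H →ₗᵢ[ℂ] H) : Symbol H → Symbol H
  | .cre f => .cre (U f)
  | .ann f => .ann (U f)

theorem quasiFreeMap_rel (U : H →ₗᵢ[ℂ] H) {x y : FreeAlgebra ℂ (Symbol H)}
    (h : FieldRel σ H x y) :
    FreeAlgebra.lift ℂ (fun s : Symbol H => gen σ (s.map U)) x =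
      FreeAlgebra.lift ℂ (fun s : Symbol H => gen σ (s.map U)) y := by
  cases h <;>
    simp only [map_add, map_mul, map_smul, FreeAlgebra.lift_ι_apply, AlgHom.commutes, Symbol.map]
  · exact cre_add σ _ _
  · exact cre_smul σ _ _
  · exact ann_add σ _ _
  · exact ann_smul σ _ _
  · exact cre_cre σ _ _
  · exact ann_ann σ _ _
  · rename_i f g
    have h := ann_cre σ (U f) (U g)
    rw [U.inner_map_map] at h
    exact h

/-- The quasi-free endomorphism of the field algebra implementing a one-particle isometry `U`:
`a*(f) ↦ a*(U f)`, `a(f) ↦ a(U f)`. -/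
def quasiFreeMap (U : H →ₗᵢ[ℂ] H) : FieldAlgebra σ H →ₐ[ℂ] FieldAlgebra σ H :=
  RingQuot.liftAlgHom ℂ ⟨FreeAlgebra.lift ℂ (fun s : Symbol H => gen σ (s.map U)),
    fun _ _ h => quasiFreeMap_rel σ U h⟩

theorem quasiFreeMap_gen (U : H →ₗᵢ[ℂ] H) (s : Symbol H) :
    quasiFreeMap σ U (gen σ s) = gen σ (s.map U) := by
  have h := RingQuot.liftAlgHom_mkAlgHom_apply ℂ
    (FreeAlgebra.lift ℂ (fun s : Symbol H => gen σ (s.map U)))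
    (fun _ _ h => quasiFreeMap_rel σ U h) (FreeAlgebra.ι ℂ s)
  rw [FreeAlgebra.lift_ι_apply] at h
  exact h

theorem quasiFreeMap_cre (U : H →ₗᵢ[ℂ] H) (f : H) :
    quasiFreeMap σ U (cre σ f) = cre σ (U f) := quasiFreeMap_gen σ U (.cre f)

theorem quasiFreeMap_ann (U : H →ₗᵢ[ℂ] H) (f : H) :
    quasiFreeMap σ U (ann σ f) = ann σ (U f) := quasiFreeMap_gen σ U (.ann f)

/-- The one-particle unitary `e^{itA}`. -/
def evolution [CompleteSpace H] (A : selfAdjoint (H →L[ℂ] H)) (t : ℝ) : H ≃ₗᵢ[ℂ] H :=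
  Unitary.linearIsometryEquiv (selfAdjoint.expUnitary (t • A))

/-- The determinant (Fermi) or the permanent (Bose) of a square matrix. -/
def Statistics.detPerm (σ : Statistics) {n : ℕ} (M : Matrix (Fin n) (Fin n) ℂ) : ℂ :=
  match σ with
  | .bose => M.permanent
  | .fermi => M.det

/-- A state: a normalized positive linear functional. -/
structure IsState (ω : FieldAlgebra σ H →ₗ[ℂ] ℂ) : Prop where
  map_one : ω 1 = 1
  nonneg_re : ∀ x, 0 ≤ (ω (star x * x)).re
  im_eq_zero : ∀ x, (ω (star x * x)).im = 0

/-- A gauge-invariant quasi-free state: the two-point function is given by an operator on the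
one-particle space, and it determines all correlation functions
`ω(a*(f₁) ⋯ a*(fₙ) a(gₘ) ⋯ a(g₁))`. -/
structure IsQuasiFreeState (ω : FieldAlgebra σ H →ₗ[ℂ] ℂ) : Prop extends IsState σ ω where
  exists_operator : ∃ T : H →L[ℂ] H, ∀ f g, ω (cre σ f * ann σ g) = ⟪g, T f⟫_ℂ
  gauge_invariant : ∀ (n m : ℕ) (f : Fin n → H) (g : Fin m → H), n ≠ m →
    ω ((List.ofFn fun i => cre σ (f i)).prod * (List.ofFn fun i => ann σ (g i)).reverse.prod) = 0
  correlation : ∀ (n : ℕ) (f g : Fin n → H),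
    ω ((List.ofFn fun i => cre σ (f i)).prod * (List.ofFn fun i => ann σ (g i)).reverse.prod)
      = σ.detPerm (Matrix.of fun i j => ω (cre σ (f i) * ann σ (g j)))

end Algebra

/-! ### One-particle dynamics on the lattice -/

/-- Macroscopic space `ℝ^d`, also used for wave vectors. -/
abbrev Space (d : ℕ) : Type := EuclideanSpace ℝ (Fin d)

/-- The microscopic lattice `ℤ^d`. -/
abbrev LatticePoint (d : ℕ) : Type := Fin d → ℤ

/-- The one-particle space `ℓ²(ℤ^d)`. -/
abbrev OneParticle (d : ℕ) : Type := lp (fun _ : LatticePoint d => ℂ) 2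

section OneParticleSection

variable {d : ℕ}

/-- The vector `δ_x` of `ℓ²(ℤ^d)`. -/
def site (x : LatticePoint d) : OneParticle d := lp.single 2 x (1 : ℂ)

/-- A lattice point as a point of `ℝ^d`. -/
def toSpace (x : LatticePoint d) : Space d := WithLp.toLp 2 fun j => (x j : ℝ)

/-- The integral part of a point of `ℝ^d`, in each coordinate. -/
def intPart (y : Space d) : LatticePoint d := fun j => ⌊y j⌋

/-- The phase `k · n`. -/
def phase (k : Space d) (n : LatticePoint d) : ℝ := ∑ j, k j * (n j : ℝ)

/-- The first Brillouin zone `[-π, π]^d`. -/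
def brillouin (d : ℕ) : Set (Space d) := {k | ∀ j, k j ∈ Set.Icc (-Real.pi) Real.pi}

/-- `H ε` is the one-particle Hamiltonian `h_ε` with kernel
`h_ε(x,y) = h(ε(x+y)/2, x-y)`, i.e. the hopping amplitude from `y` to `x`. -/
def IsHamiltonian (h : Space d → LatticePoint d → ℂ)
    (H : ℝ → selfAdjoint (OneParticle d →L[ℂ] OneParticle d)) : Prop :=
  ∀ ε > 0, ∀ x y : LatticePoint d,
    ⟪site x, (H ε : OneParticle d →L[ℂ] OneParticle d) (site y)⟫_ℂ =
      h ((ε / 2) • toSpace (x + y)) (x - y)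

/-- The energy spectrum `E(r,k) = ∑_v e^{-ik·v} h(r,v)` (real, since `h(r,-v)` is the complex
conjugate of `h(r,v)`). -/
def energy (h : Space d → LatticePoint d → ℂ) (r k : Space d) : ℝ :=
  (∑' v : LatticePoint d, Complex.exp (-(Complex.I * (phase k v : ℂ))) * h r v).re

/-- `(r t x k, κ t x k)` is the solution at time `t` of Hamilton's equations
`∂_t r = ∂_k E(r,k)`, `∂_t k = -∂_r E(r,k)` started at `(x, k)`; it exists for all times and
depends continuously on the initial point. -/
structure IsHamiltonFlow (E : Space d → Space d → ℝ) (r κ : ℝ → Space d → Space d → Space d) :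
    Prop where
  position_zero : ∀ x k, r 0 x k = x
  momentum_zero : ∀ x k, κ 0 x k = k
  position_deriv : ∀ t x k, HasDerivAt (fun t' => r t' x k)
    (gradient (fun p => E (r t x k) p) (κ t x k)) t
  momentum_deriv : ∀ t x k, HasDerivAt (fun t' => κ t' x k)
    (-gradient (fun q => E q (κ t x k)) (r t x k)) t
  position_continuous : ∀ t, Continuous fun p : Space d × Space d => r t p.1 p.2
  momentum_continuous : ∀ t, Continuous fun p : Space d × Space d => κ t p.1 p.2

theorem memℓp_translate (a : LatticePoint d) (u : OneParticle d) :
    Memℓp (fun n : LatticePoint d => u (n - a)) 2 := by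
  have h := (lp.memℓp u).summable (by norm_num)
  exact memℓp_gen ((Equiv.subRight a).summable_iff.mpr h)

/-- Translation by `a`: `(T_a u)(n) = u(n - a)`. -/
def translate (a : LatticePoint d) (u : OneParticle d) : OneParticle d :=
  ⟨fun n => u (n - a), memℓp_translate a u⟩

/-- The `j`-th component of the position operator, with its maximal domain. -/
def position (j : Fin d) : OneParticle d →ₗ.[ℂ] OneParticle d where
  domain :=
    { carrier := {u | Memℓp (fun x : LatticePoint d => ((x j : ℤ) : ℂ) * u x) 2}
      add_mem' := fun {u v} hu hv => by
        have h := hu.add hv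
        have e : (fun x : LatticePoint d => ((x j : ℤ) : ℂ) * (u + v) x) =
            (fun x : LatticePoint d => ((x j : ℤ) : ℂ) * u x) + fun x => ((x j : ℤ) : ℂ) * v x := by
          funext x
          simp [mul_add]
        rw [Set.mem_ofPred_eq, e]
        exact h
      zero_mem' := by
        have e : (fun x : LatticePoint d => ((x j : ℤ) : ℂ) * (0 : OneParticle d) x) = 0 := by
          funext x
          simp
        rw [Set.mem_ofPred_eq, e]
        exact zero_memℓp
      smul_mem' := fun c u hu => by
        have h := hu.const_smul c
        have e : (fun x : LatticePoint d => ((x j : ℤ) : ℂ) * (c • u) x) =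
            c • fun x : LatticePoint d => ((x j : ℤ) : ℂ) * u x := by
          funext x
          simp [mul_left_comm]
        rw [Set.mem_ofPred_eq, e]
        exact h }
  toFun :=
    { toFun := fun u => ⟨fun x : LatticePoint d => ((x j : ℤ) : ℂ) * u.1 x, u.2⟩
      map_add' := fun u v => by
        ext x
        exact mul_add _ _ _
      map_smul' := fun c u => by
        ext x
        exact mul_left_comm _ _ _ }

/-- The `j`-th component of the rescaled Heisenberg position operator
`r^ε(t) = ε r(t/ε)`, `r(t) = e^{itH} r e^{-itH}`, on its natural domain. -/
def rescaledPosition (H : selfAdjoint (OneParticle d →L[ℂ] OneParticle d)) (ε t : ℝ) (j : Fin d) :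
    OneParticle d →ₗ.[ℂ] OneParticle d where
  domain := (position j).domain.comap
    ((evolution H (t / ε)).symm.toLinearEquiv : OneParticle d →ₗ[ℂ] OneParticle d)
  toFun := (ε : ℂ) • (((evolution H (t / ε)).toLinearEquiv : OneParticle d →ₗ[ℂ] OneParticle d) ∘ₗ
    (position j).toFun ∘ₗ
      (((evolution H (t / ε)).symm.toLinearEquiv : OneParticle d →ₗ[ℂ] OneParticle d).restrict
        (fun _ hu => hu)))

/-- `v = m(k) u`: the vector `v` is the image of `u` under the operator which is multiplication by
`m` in the wave vector representation, i.e. convolution with the Fourier coefficients of `m`. -/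
def IsMultiplierImage (m : Space d → ℝ) (u v : OneParticle d) : Prop :=
  ∀ n : LatticePoint d, v n = ∑' n' : LatticePoint d,
    (((2 * Real.pi) ^ d : ℝ) : ℂ)⁻¹ * (∫ k in brillouin d,
      (m k : ℂ) * Complex.exp (Complex.I * (phase k (n - n') : ℂ))) * u n'

/-- The rescaled position operator `r^ε(t)` converges on the domain `D` to the operator `r(t)` with
symbol `r(x,k;t)`: seen from the lattice point next to the macroscopic point `x`, the vector
`r^ε(t) u`, `u ∈ D`, is close in `ℓ²` to `r(x,·;t) u`, where `r(x,·;t)` acts as a function of the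
wave vector. -/
def PositionConverges (D : Submodule ℂ (OneParticle d))
    (H : ℝ → selfAdjoint (OneParticle d →L[ℂ] OneParticle d))
    (r : ℝ → Space d → Space d → Space d) : Prop :=
  ∀ (t : ℝ) (x : Space d) (j : Fin d), ∀ u ∈ D, ∃ v : OneParticle d,
    IsMultiplierImage (fun k => r t x k j) u v ∧
    ∀ δ > 0, ∀ᶠ ε in 𝓝[>] (0 : ℝ),
      ∃ hu : translate (intPart (ε⁻¹ • x)) u ∈ (rescaledPosition (H ε) ε t j).domain,
        ‖rescaledPosition (H ε) ε t j ⟨translate (intPart (ε⁻¹ • x)) u, hu⟩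
          - translate (intPart (ε⁻¹ • x)) v‖ < δ

/-- The Fourier transform `ψ̃(q) = (2π)^{-d/2} ∫ ψ(x) e^{-iq·x} dx`. -/
def fourierTransform (ψ : Space d → ℂ) (q : Space d) : ℂ :=
  (((2 * Real.pi) ^ (-(d : ℝ) / 2) : ℝ) : ℂ) *
    ∫ x, ψ x * Complex.exp (-(Complex.I * ((⟪q, x⟫_ℝ : ℝ) : ℂ)))

/-- `(e^{ir(t)}ψ)(x,k) = (2π)^{-d/2} ∫ ψ̃(q) e^{iq·r(x,k;t)} dq`. -/
def expPosition (r : ℝ → Space d → Space d → Space d) (t : ℝ) (ψ : Space d → ℂ)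
    (x k : Space d) : ℂ :=
  (((2 * Real.pi) ^ (-(d : ℝ) / 2) : ℝ) : ℂ) *
    ∫ q, fourierTransform ψ q * Complex.exp (Complex.I * ((⟪q, r t x k⟫_ℝ : ℝ) : ℂ))

/-! ### Wigner function, clustering and density fluctuations -/

variable (σ : Statistics)

/-- The quasi-free time evolution `α_t` with one-particle Hamiltonian `H`. -/
def timeEvolution (H : selfAdjoint (OneParticle d →L[ℂ] OneParticle d)) (t : ℝ) :
    FieldAlgebra σ (OneParticle d) →ₐ[ℂ] FieldAlgebra σ (OneParticle d) :=
  quasiFreeMap σ (evolution H t).toLinearIsometry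

variable {σ}

/-- The two-point function `ω_t[a*(x) a(y)]`, `ω_t = ω ∘ α_t`. -/
def twoPoint (ω : FieldAlgebra σ (OneParticle d) →ₗ[ℂ] ℂ)
    (H : selfAdjoint (OneParticle d →L[ℂ] OneParticle d)) (t : ℝ) (x y : LatticePoint d) : ℂ :=
  ω (timeEvolution σ H t (cre σ (site x) * ann σ (site y)))

/-- The macroscopic one-particle distribution (Wigner) function
`f^ε(r,k;t) = (2π)^{-d} ∑_η e^{iη·k} ω_{t/ε}[a*(r/ε + η/2) a(r/ε - η/2)]`, where the lattice sites
are the integral parts of `r/ε ± η/2`. -/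
def wigner (ω : FieldAlgebra σ (OneParticle d) →ₗ[ℂ] ℂ)
    (H : selfAdjoint (OneParticle d →L[ℂ] OneParticle d)) (ε t : ℝ) (r k : Space d) : ℂ :=
  (((2 * Real.pi) ^ d : ℝ) : ℂ)⁻¹ * ∑' η : LatticePoint d,
    Complex.exp (Complex.I * (phase k η : ℂ)) *
      twoPoint ω H (t / ε) (intPart (ε⁻¹ • r + (2⁻¹ : ℝ) • toSpace η))
        (intPart (ε⁻¹ • r - (2⁻¹ : ℝ) • toSpace η))

/-- Clustering: at each macroscopic time the two-point functions decay summably in the separation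
of the two points, uniformly in the position and in the scale. -/
def Clusters (ω : ℝ → FieldAlgebra σ (OneParticle d) →ₗ[ℂ] ℂ)
    (H : ℝ → selfAdjoint (OneParticle d →L[ℂ] OneParticle d)) : Prop :=
  ∀ t : ℝ, ∃ g : LatticePoint d → ℝ, Summable g ∧
    ∀ᶠ ε in 𝓝[>] (0 : ℝ), ∀ x η : LatticePoint d, ‖twoPoint (ω ε) (H ε) (t / ε) (x + η) x‖ ≤ g η

/-- The density fluctuation field
`ξ^ε(ψ,t) = ε^{d/2} ∑_x ψ(εx) [α_{t/ε}(a*(x)a(x)) - ω(α_{t/ε}(a*(x)a(x)))]`. -/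
def fluctuation (ω : FieldAlgebra σ (OneParticle d) →ₗ[ℂ] ℂ)
    (H : selfAdjoint (OneParticle d →L[ℂ] OneParticle d)) (ε : ℝ) (ψ : Space d → ℂ) (t : ℝ) :
    FieldAlgebra σ (OneParticle d) :=
  ((ε ^ ((d : ℝ) / 2) : ℝ) : ℂ) • ∑ᶠ x : LatticePoint d, ψ (ε • toSpace x) •
    (timeEvolution σ H (t / ε) (cre σ (site x) * ann σ (site x))
      - algebraMap ℂ (FieldAlgebra σ (OneParticle d)) (twoPoint ω H (t / ε) x x))

/-- The limiting covariance density
`(e^{ir(τ)}ψ)(x,k) φ(x) f(x,k) (1 + ζ (2π)^d f(x,k))`, with `ζ = 1` for Bose and `ζ = -1` for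
Fermi statistics. -/
def covarianceDensity (σ : Statistics) (r : ℝ → Space d → Space d → Space d) (τ : ℝ)
    (ψ φ : Space d → ℂ) (f : Space d → Space d → ℝ) (p : Space d × Space d) : ℂ :=
  expPosition r τ ψ p.1 p.2 * φ p.1 * (f p.1 p.2 : ℂ) *
    (1 + σ.sign * ((((2 * Real.pi) ^ d * f p.1 p.2 : ℝ)) : ℂ))

end OneParticleSection

end QuasiFree

end

open QuasiFree

noncomputable section

namespace QuasiFree

open BoundedContinuousFunction

/-! ### Truncated four-point functions -/

section FourPoint

variable {H : Type*} [NormedAddCommGroup H] [InnerProductSpace ℂ H] {σ : Statistics}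

/-! Write `U_t` for the one-particle evolution at microscopic time `t/ε` and `T` for the operator
giving the two-point function of the state. By Wick's rule the truncated correlation of two
densities is `ω(a*(u)a(v)) (⟨u,v⟩ + ζ ω(a*(v)a(u)))` (`truncated_density`).

With `u = U_t δ_x`, `v = U_s δ_y`, the sum over `x` weighted by `ψ(εx)` is a matrix element of the
operator `ψ(r^ε(t-s))`. After translating `y` to the origin the covariance becomes `ε^d ∑_y φ(εy)
⟨v_y, ψ(r^ε(t-s)) (δ_0 + ζ u_y)⟩`, where `u_y` and `v_y` are `U_s⁻¹ T U_s δ_y` and `U_s⁻¹ T* U_s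
δ_y` seen from `y`. This sum is exactly the integral over `x` of a step function
(`covariance_eq_integral`), so the theorem reduces to convergence of the integrand at almost every
`x` and a bound on it.

Operators (`tendsto_heisenberg`): convergence of the positions on a dense domain gives strong
convergence of their resolvents. Polynomials in the resolvents at `±i` uniformly approximate
compactly supported functions, so `ψ(r^ε(t-s))`, seen from `x/ε`, converges strongly to
multiplication by `ψ(r(x,k;t-s))`. Fourier inversion identifies this symbol with
`(e^{ir(t-s)}ψ)(x,k)`.

Vectors (`tendsto_correlation`, `exists_subseq_ae_tendsto_tsum`): the coefficients of `u_y`, `v_y`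
are two-point functions at time `s`. Fourier inversion and dominated convergence turn pointwise
convergence of `f^ε` into convergence of two-point functions centred at the midpoint of their two
sites. In `u_y`, `v_y` the base point is an end point instead, which is a macroscopic shift by
`εη/2`. Pointwise convergence does not survive a moving argument, but convergence in `L¹` does, by
continuity of translations. Together with the summable bound this gives `ℓ²` convergence for almost
every `x` along a subsequence, the limit having wave function `(2π)^d f(x,·;s)`.

Since `δ_0` is the constant function `1` of the wave vector, Parseval's identity yields the factor
`f (1 + ζ(2π)^d f)`. Clustering supplies the dominating constant, and a subsequence of every
sequence suffices because the limit is always the same. -/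

theorem IsQuasiFreeState.two_cre_two_ann {ω : FieldAlgebra σ H →ₗ[ℂ] ℂ}
    (hω : IsQuasiFreeState σ ω) (u v : H) :
    ω (cre σ u * cre σ v * (ann σ u * ann σ v)) =
      ω (cre σ u * ann σ v) * ω (cre σ v * ann σ u)
        + σ.sign * (ω (cre σ u * ann σ u) * ω (cre σ v * ann σ v)) := by
  -- The annihilators enter the correlation formula in reverse order, so `![v, u]` produces `a(u)
  -- a(v)`.
  have h := hω.correlation 2 ![u, v] ![v, u]
  simp only [List.ofFn_succ, List.ofFn_zero, List.prod_cons, List.prod_nil, List.reverse_cons,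
    List.reverse_nil, List.nil_append, List.prod_append, mul_one, Matrix.cons_val_zero,
    Matrix.cons_val_succ] at h
  rw [h]
  cases σ
  · rw [Statistics.detPerm, Matrix.permanent, Finset.univ_perm_fin_succ]
    simp [Fin.prod_univ_two, Statistics.sign, Finset.sum_map, Finset.univ_product_univ.symm,
      Fin.sum_univ_two]
    ring
  · rw [Statistics.detPerm, Matrix.det_fin_two]
    simp [Statistics.sign]
    ring

/-- Moving `a(u)` past `a*(v)` costs `ζ` and leaves the contraction `⟨u,v⟩`. The disconnected part
of the normally ordered term carries a second `ζ`, and `ζ² = 1` makes it cancel against the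
subtracted means. -/
theorem IsQuasiFreeState.truncated_density {ω : FieldAlgebra σ H →ₗ[ℂ] ℂ}
    (hω : IsQuasiFreeState σ ω) (u v : H) :
    ω ((cre σ u * ann σ u - algebraMap ℂ _ (ω (cre σ u * ann σ u))) *
        (cre σ v * ann σ v - algebraMap ℂ _ (ω (cre σ v * ann σ v)))) =
      ω (cre σ u * ann σ v) * (⟪u, v⟫_ℂ + σ.sign * ω (cre σ v * ann σ u)) := by
  have hs : σ.sign * σ.sign = 1 := by cases σ <;> simp [Statistics.sign]
  have e1 : cre σ u * ann σ u * (cre σ v * ann σ v) =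
      σ.sign • (cre σ u * cre σ v * (ann σ u * ann σ v)) + ⟪u, v⟫_ℂ • (cre σ u * ann σ v) := by
    rw [mul_assoc, ← mul_assoc (ann σ u), ann_cre, add_mul, mul_add, Algebra.algebraMap_eq_smul_one]
    simp only [smul_mul_assoc, mul_smul_comm, one_mul, mul_assoc]
  simp only [Algebra.algebraMap_eq_smul_one, mul_sub, sub_mul, smul_mul_assoc, mul_smul_comm,
    one_mul, mul_one, e1, map_sub, map_add, map_smul, hω.map_one, hω.two_cre_two_ann, smul_eq_mul]
  linear_combination (ω (cre σ u * ann σ u) * ω (cre σ v * ann σ v)) * hs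

end FourPoint

variable {d : ℕ} {σ : Statistics}

theorem timeEvolution_density (H : selfAdjoint (OneParticle d →L[ℂ] OneParticle d)) (t : ℝ)
    (x y : LatticePoint d) :
    timeEvolution σ H t (cre σ (site x) * ann σ (site y)) =
      cre σ (evolution H t (site x)) * ann σ (evolution H t (site y)) := by
  rw [timeEvolution, map_mul, quasiFreeMap_cre, quasiFreeMap_ann]
  rfl

theorem fluctuation_eq_sum (ω : FieldAlgebra σ (OneParticle d) →ₗ[ℂ] ℂ)
    (H : selfAdjoint (OneParticle d →L[ℂ] OneParticle d)) (ε : ℝ) (ψ : Space d → ℂ) (t : ℝ)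
    (S : Finset (LatticePoint d)) (hS : ∀ x, ψ (ε • toSpace x) ≠ 0 → x ∈ S) :
    fluctuation ω H ε ψ t = ((ε ^ ((d : ℝ) / 2) : ℝ) : ℂ) • ∑ x ∈ S, ψ (ε • toSpace x) •
      (cre σ (evolution H (t / ε) (site x)) * ann σ (evolution H (t / ε) (site x)) -
        algebraMap ℂ _ (ω (cre σ (evolution H (t / ε) (site x)) *
          ann σ (evolution H (t / ε) (site x))))) := by
  rw [fluctuation, finsum_eq_sum_of_support_subset (s := S)]
  · simp only [twoPoint, timeEvolution_density]
  · intro x hx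
    refine hS x fun h0 => hx ?_
    simp only [h0, zero_smul]

/-- The sum over `x` is put innermost because, at fixed `y`, it will be recognised as a matrix
element of a function of the position operators. A single finite set `S` serves both test functions.
-/
theorem covariance_eq_sum {ω : FieldAlgebra σ (OneParticle d) →ₗ[ℂ] ℂ}
    (hω : IsQuasiFreeState σ ω)
    (H : selfAdjoint (OneParticle d →L[ℂ] OneParticle d)) {ε : ℝ} (hε : 0 < ε)
    (ψ φ : Space d → ℂ) (t s : ℝ) (S : Finset (LatticePoint d))
    (hψ : ∀ x, ψ (ε • toSpace x) ≠ 0 → x ∈ S) (hφ : ∀ x, φ (ε • toSpace x) ≠ 0 → x ∈ S) :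
    ω (fluctuation ω H ε ψ t * fluctuation ω H ε φ s) =
      ((ε ^ d : ℝ) : ℂ) * ∑ y ∈ S, φ (ε • toSpace y) * ∑ x ∈ S, ψ (ε • toSpace x) *
        (ω (cre σ (evolution H (t / ε) (site x)) * ann σ (evolution H (s / ε) (site y))) *
          (⟪evolution H (t / ε) (site x), evolution H (s / ε) (site y)⟫_ℂ + σ.sign *
            ω (cre σ (evolution H (s / ε) (site y)) *
              ann σ (evolution H (t / ε) (site x))))) := by
  have hd : ((ε ^ d : ℝ) : ℂ) = ((ε ^ ((d : ℝ) / 2) : ℝ) : ℂ) * ((ε ^ ((d : ℝ) / 2) : ℝ) : ℂ) := by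
    rw [← Complex.ofReal_mul, ← Real.rpow_add hε, add_halves, Real.rpow_natCast]
  rw [fluctuation_eq_sum ω H ε ψ t S hψ, fluctuation_eq_sum ω H ε φ s S hφ, hd]
  simp only [smul_mul_assoc, mul_smul_comm, Finset.sum_mul_sum, map_smul, map_sum,
    hω.truncated_density, smul_eq_mul, mul_assoc]
  simp only [Finset.mul_sum]
  rw [Finset.sum_comm]

/-! ### Operators on the one-particle space -/

section LatticeOperators

variable {d : ℕ}

theorem inner_site (x : LatticePoint d) (u : OneParticle d) : ⟪site x, u⟫_ℂ = u x := by
  rw [site, lp.inner_single_left]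
  simp

theorem norm_site (x : LatticePoint d) : ‖site x‖ = 1 := by
  rw [site, lp.norm_single (by norm_num), norm_one]

theorem site_apply (x y : LatticePoint d) : site x y = if y = x then 1 else 0 := by
  rw [site, lp.coeFn_single, Pi.single_apply]

theorem norm_sq_eq_tsum (u : OneParticle d) : ‖u‖ ^ 2 = ∑' n, ‖u n‖ ^ 2 := by
  have h := lp.norm_rpow_eq_tsum (p := 2) (by norm_num) u
  simpa only [ENNReal.toReal_ofNat, Real.rpow_ofNat] using h

theorem memℓp_bounded_mul (m : LatticePoint d → ℂ) {C : ℝ} (hm : ∀ n, ‖m n‖ ≤ C)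
    (u : OneParticle d) : Memℓp (fun n => m n * u n) 2 := by
  refine memℓp_gen (Summable.of_nonneg_of_le (fun n => by positivity) (fun n => ?_)
    (((lp.memℓp u).summable (by norm_num)).mul_left (C ^ (2 : ENNReal).toReal)))
  have hC : 0 ≤ C := (norm_nonneg _).trans (hm n)
  rw [norm_mul, Real.mul_rpow (norm_nonneg _) (norm_nonneg _)]
  gcongr
  exact hm n

/-- Multiplication by a bounded continuous function of `ε x` in the position representation. -/
def diagonal (ε : ℝ) (F : Space d →ᵇ ℂ) : OneParticle d →L[ℂ] OneParticle d :=
  LinearMap.mkContinuous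
    { toFun := fun u => ⟨fun n => F (ε • toSpace n) * u n,
        memℓp_bounded_mul _ (fun n => F.norm_coe_le_norm _) u⟩
      map_add' := fun u v => by
        ext n
        exact mul_add _ _ _
      map_smul' := fun c u => by
        ext n
        exact mul_left_comm _ _ _ } ‖F‖ <| fun u => by
    refine (sq_le_sq₀ (norm_nonneg _) (by positivity)).1 ?_
    rw [mul_pow, norm_sq_eq_tsum, norm_sq_eq_tsum, ← tsum_mul_left]
    have hu := (lp.memℓp u).summable (by norm_num)
    simp only [ENNReal.toReal_ofNat, Real.rpow_ofNat] at hu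
    have hle : ∀ n, ‖F (ε • toSpace n) * u n‖ ^ 2 ≤ ‖F‖ ^ 2 * ‖u n‖ ^ 2 := fun n => by
      rw [norm_mul, mul_pow]
      gcongr
      exact F.norm_coe_le_norm _
    exact Summable.tsum_le_tsum hle
      (Summable.of_nonneg_of_le (fun _ => by positivity) hle (hu.mul_left _)) (hu.mul_left _)

theorem diagonal_apply (ε : ℝ) (F : Space d →ᵇ ℂ) (u : OneParticle d) (n : LatticePoint d) :
    diagonal ε F u n = F (ε • toSpace n) * u n := rfl

theorem norm_diagonal_le (ε : ℝ) (F : Space d →ᵇ ℂ) : ‖diagonal ε F‖ ≤ ‖F‖ :=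
  LinearMap.mkContinuous_norm_le _ (norm_nonneg _) _

/-- Functional calculus of the rescaled position operators. -/
def diagonalHom (ε : ℝ) : (Space d →ᵇ ℂ) →ₐ[ℂ] (OneParticle d →L[ℂ] OneParticle d) :=
  AlgHom.ofLinearMap
    { toFun := diagonal ε
      map_add' := fun F G => by
        ext u n
        exact add_mul _ _ _
      map_smul' := fun c F => by
        ext u n
        exact mul_assoc _ _ _ }
    (by
      ext u n
      exact one_mul _)
    (fun F G => by
      ext u n
      exact mul_assoc _ _ _)

/-- When only finitely many lattice values matter, the operator has finite rank and is `∑ F(εx)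
|δ_x⟩⟨δ_x|`. Read backwards, this turns the sum over `x` in the covariance into an operator. -/
theorem diagonal_eq_sum (ε : ℝ) (F : Space d →ᵇ ℂ) (S : Finset (LatticePoint d))
    (hS : ∀ x, F (ε • toSpace x) ≠ 0 → x ∈ S) (u v : OneParticle d) :
    ⟪u, diagonal ε F v⟫_ℂ =
      ∑ x ∈ S, F (ε • toSpace x) * (⟪u, site x⟫_ℂ * ⟪site x, v⟫_ℂ) := by
  have e : diagonal ε F v = ∑ x ∈ S, (F (ε • toSpace x) * v x) • site x := by
    ext n
    rw [diagonal_apply, lp.coeFn_sum, Finset.sum_apply]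
    simp only [lp.coeFn_smul, Pi.smul_apply, site_apply, smul_eq_mul, mul_ite, mul_one, mul_zero,
      Finset.sum_ite_eq]
    split_ifs with h
    · rfl
    · rw [not_imp_comm.1 (hS n) h, zero_mul]
  rw [e, inner_sum]
  refine Finset.sum_congr rfl fun x _ => ?_
  rw [inner_smul_right, inner_site]
  ring

/-- Translations as unitary operators. -/
def translation (a : LatticePoint d) : OneParticle d ≃ₗᵢ[ℂ] OneParticle d where
  toFun := translate a
  invFun := translate (-a)
  map_add' u v := by
    ext n
    rfl
  map_smul' c u := by
    ext n
    rfl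
  left_inv u := by
    ext n
    simp [translate]
  right_inv u := by
    ext n
    simp [translate]
  norm_map' u := by
    have h : ‖translate a u‖ ^ 2 = ‖u‖ ^ 2 := by
      rw [norm_sq_eq_tsum, norm_sq_eq_tsum]
      exact (Equiv.subRight a).tsum_eq fun n => ‖u n‖ ^ 2
    exact (sq_eq_sq₀ (norm_nonneg _) (norm_nonneg _)).1 h

theorem translation_apply (a : LatticePoint d) (u : OneParticle d) :
    translation a u = translate a u := rfl

theorem translation_symm_apply (a : LatticePoint d) (u : OneParticle d) (n : LatticePoint d) :
    (translation a).symm u n = u (n + a) := by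
  change u (n - -a) = _
  rw [sub_neg_eq_add]

/-- Conjugation of operators by a unitary. -/
def conjHom {E : Type*} [NormedAddCommGroup E] [NormedSpace ℂ E] (U : E ≃ₗᵢ[ℂ] E) :
    (E →L[ℂ] E) →ₐ[ℂ] (E →L[ℂ] E) :=
  AlgHom.ofLinearMap
    { toFun := fun A => (U : E →L[ℂ] E) ∘L A ∘L (U.symm : E →L[ℂ] E)
      map_add' := fun A B => by
        ext u
        simp
      map_smul' := fun c A => by
        ext u
        simp }
    (by
      ext u
      simp)
    (fun A B => by
      ext u
      simp)

theorem conjHom_apply {E : Type*} [NormedAddCommGroup E] [NormedSpace ℂ E] (U : E ≃ₗᵢ[ℂ] E)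
    (A : E →L[ℂ] E) (u : E) : conjHom U A u = U (A (U.symm u)) := rfl

theorem norm_conjHom_le {E : Type*} [NormedAddCommGroup E] [NormedSpace ℂ E] (U : E ≃ₗᵢ[ℂ] E)
    (A : E →L[ℂ] E) : ‖conjHom U A‖ ≤ ‖A‖ := by
  refine ContinuousLinearMap.opNorm_le_bound _ (norm_nonneg _) fun u => ?_
  rw [conjHom_apply, U.norm_map]
  exact (A.le_opNorm _).trans_eq (by rw [U.symm.norm_map])

theorem evolution_add {E : Type*} [NormedAddCommGroup E] [InnerProductSpace ℂ E] [CompleteSpace E]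
    (A : selfAdjoint (E →L[ℂ] E)) (t s : ℝ) (u : E) :
    evolution A (t + s) u = evolution A t (evolution A s u) := by
  have hc : Commute (t • A : E →L[ℂ] E) (s • A : E →L[ℂ] E) :=
    ((Commute.refl (A : E →L[ℂ] E)).smul_left t).smul_right s
  have h := Commute.expUnitary_add (a := t • A) (b := s • A) hc
  have e : (t + s) • A = t • A + s • A := Subtype.ext (add_smul t s (A : E →L[ℂ] E))
  rw [evolution, evolution, evolution, e, h]
  rfl

end LatticeOperators

/-! ### Fourier series on the Brillouin zone -/

section Fourier

variable {d : ℕ}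

theorem measurableSet_brillouin : MeasurableSet (brillouin d) := by
  have : brillouin d = ⋂ j, (fun k : Space d => k j) ⁻¹' Set.Icc (-Real.pi) Real.pi := by
    ext k
    simp [brillouin]
  rw [this]
  exact MeasurableSet.iInter fun j => measurableSet_Icc.preimage (by fun_prop)

theorem isCompact_brillouin : IsCompact (brillouin d) := by
  have h := (isCompact_univ_pi fun _ : Fin d =>
    isCompact_Icc (a := -Real.pi) (b := Real.pi)).image (PiLp.continuous_toLp 2 (fun _ : Fin d => ℝ))
  convert h using 1
  ext k
  simp only [brillouin, Set.mem_ofPred_eq, Set.mem_image, Set.mem_univ_pi]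
  exact ⟨fun hk => ⟨WithLp.ofLp k, hk, rfl⟩, by rintro ⟨x, hx, rfl⟩; exact hx⟩

/-- Normalized Lebesgue measure on the Brillouin zone. -/
def brillouinMeasure (d : ℕ) : Measure (Space d) :=
  ENNReal.ofReal ((2 * Real.pi) ^ d)⁻¹ • volume.restrict (brillouin d)

instance : IsFiniteMeasure (brillouinMeasure d) := by
  have : IsFiniteMeasure (volume.restrict (brillouin d)) :=
    ⟨by simpa using isCompact_brillouin.measure_lt_top⟩
  exact Measure.smul_finite _ ENNReal.ofReal_ne_top

theorem integral_brillouinMeasure (F : Space d → ℂ) :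
    ∫ k, F k ∂brillouinMeasure d =
      (((2 * Real.pi) ^ d : ℝ) : ℂ)⁻¹ * ∫ k in brillouin d, F k := by
  rw [brillouinMeasure, integral_smul_measure, ENNReal.toReal_ofReal (by positivity),
    Complex.real_smul, Complex.ofReal_inv]

theorem ae_brillouinMeasure_iff (p : Space d → Prop) :
    (∀ᵐ k ∂brillouinMeasure d, p k) ↔ ∀ᵐ k ∂volume.restrict (brillouin d), p k := by
  rw [brillouinMeasure, Measure.ae_ennreal_smul_measure_iff]
  simp only [ne_eq, ENNReal.ofReal_eq_zero, not_le]
  positivity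

theorem ae_mem_brillouin : ∀ᵐ k ∂brillouinMeasure d, k ∈ brillouin d :=
  (ae_brillouinMeasure_iff _).2 (ae_restrict_mem measurableSet_brillouin)

theorem measurePreserving_ofLp_brillouin :
    MeasurePreserving (WithLp.ofLp : Space d → Fin d → ℝ) (volume.restrict (brillouin d))
      (Measure.pi fun _ => volume.restrict (Set.Icc (-Real.pi) Real.pi)) := by
  have h := (PiLp.volume_preserving_ofLp (Fin d)).restrict_preimage
    (s := Set.univ.pi fun _ => Set.Icc (-Real.pi) Real.pi)
    (MeasurableSet.univ_pi fun _ => measurableSet_Icc)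
  rw [volume_pi, Measure.restrict_pi_pi] at h
  have e : brillouin d =
      WithLp.ofLp ⁻¹' (Set.univ.pi fun _ => Set.Icc (-Real.pi) Real.pi) := by
    ext k
    simp only [brillouin, Set.mem_ofPred_eq, Set.mem_preimage, Set.mem_univ_pi]
  rw [e]
  exact h

/-- The closed zone covers the torus with overlapping faces; `toTorus` is inverted only on a
half-open cell, and the omitted faces are null sets. -/
theorem ae_mem_Ico : ∀ᵐ k ∂brillouinMeasure d, ∀ j, k j ∈ Set.Ico (-Real.pi) Real.pi := by
  rw [ae_brillouinMeasure_iff]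
  have h : ∀ᵐ k ∂Measure.pi fun _ : Fin d => volume.restrict (Set.Icc (-Real.pi) Real.pi),
      ∀ j, k j ∈ Set.Ico (-Real.pi) Real.pi := by
    rw [ae_all_iff]
    intro j
    refine Measure.tendsto_eval_ae_ae.eventually (p := fun x => x ∈ Set.Ico (-Real.pi) Real.pi) ?_
    rw [← restrict_Ico_eq_restrict_Icc]
    exact ae_restrict_mem measurableSet_Ico
  exact measurePreserving_ofLp_brillouin.quasiMeasurePreserving.ae h

/-- The character `k ↦ e^{-ik·n}`. -/
def character (n : LatticePoint d) : Space d →ᵇ ℂ :=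
  BoundedContinuousFunction.ofNormedAddCommGroup
    (fun k => Complex.exp (-(Complex.I * (phase k n : ℂ))))
    (by unfold phase; fun_prop) 1 fun k => by
      rw [mul_comm, ← neg_mul, ← Complex.ofReal_neg, Complex.norm_exp_ofReal_mul_I]

theorem character_apply (n : LatticePoint d) (k : Space d) :
    character n k = Complex.exp (-(Complex.I * (phase k n : ℂ))) := rfl

theorem phase_add (k : Space d) (n m : LatticePoint d) :
    phase k (n + m) = phase k n + phase k m := by
  simp [phase, mul_add, Finset.sum_add_distrib]

theorem phase_neg (k : Space d) (n : LatticePoint d) : phase k (-n) = -phase k n := by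
  simp [phase]

theorem phase_sub (k : Space d) (n m : LatticePoint d) :
    phase k (n - m) = phase k n - phase k m := by
  rw [sub_eq_add_neg, phase_add, phase_neg, sub_eq_add_neg]

theorem conj_character (n : LatticePoint d) (k : Space d) :
    starRingEnd ℂ (character n k) = Complex.exp (Complex.I * (phase k n : ℂ)) := by
  rw [character_apply, ← Complex.exp_conj]
  simp

theorem integral_exp_Icc (m : ℤ) :
    ∫ x in Set.Icc (-Real.pi) Real.pi, Complex.exp (Complex.I * ((x * m : ℝ) : ℂ)) =
      if m = 0 then 2 * (Real.pi : ℂ) else 0 := by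
  rw [integral_Icc_eq_integral_Ioc, ← intervalIntegral.integral_of_le (by linarith [Real.pi_pos])]
  split_ifs with h
  · simp only [h, Int.cast_zero, mul_zero, Complex.ofReal_zero, Complex.exp_zero,
      intervalIntegral.integral_const, Complex.real_smul]
    push_cast
    ring
  · have hc : Complex.I * m ≠ 0 := mul_ne_zero Complex.I_ne_zero (by exact_mod_cast h)
    have e : ∀ x : ℝ, Complex.exp (Complex.I * ((x * m : ℝ) : ℂ)) =
        Complex.exp (Complex.I * m * x) := fun x => by
      push_cast
      ring_nf
    simp only [e]
    rw [integral_exp_mul_complex hc, div_eq_zero_iff, sub_eq_zero]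
    left
    rw [Complex.exp_eq_exp_iff_exists_int]
    exact ⟨m, by push_cast; ring⟩

theorem integral_exp_phase (n : LatticePoint d) :
    ∫ k, Complex.exp (Complex.I * (phase k n : ℂ)) ∂brillouinMeasure d = if n = 0 then 1 else 0 := by
  have h := measurePreserving_ofLp_brillouin.integral_comp
    (MeasurableEquiv.toLp 2 (Fin d → ℝ)).symm.measurableEmbedding
    (fun x : Fin d → ℝ => ∏ j, Complex.exp (Complex.I * ((x j * n j : ℝ) : ℂ)))
  rw [integral_fintype_prod_eq_prod (f := fun j (x : ℝ) =>
    Complex.exp (Complex.I * ((x * n j : ℝ) : ℂ)))] at h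
  simp only [integral_exp_Icc] at h
  have e : ∀ k : Space d, Complex.exp (Complex.I * (phase k n : ℂ)) =
      ∏ j, Complex.exp (Complex.I * ((k j * n j : ℝ) : ℂ)) := fun k => by
    rw [← Complex.exp_sum, phase, Complex.ofReal_sum, Finset.mul_sum]
  rw [integral_brillouinMeasure]
  simp only [e]
  rw [h]
  split_ifs with h0
  · have : ((2 * Real.pi : ℂ)) ≠ 0 := by
      exact_mod_cast (by positivity : (2 * Real.pi : ℝ) ≠ 0)
    simp [h0]
  · obtain ⟨j, hj⟩ := Function.ne_iff.1 h0
    rw [Finset.prod_eq_zero (Finset.mem_univ j) (if_neg (by simpa using hj)), mul_zero]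

/-- The space of square integrable functions of the wave vector. -/
abbrev WaveSpace (d : ℕ) : Type := Lp ℂ 2 (brillouinMeasure d)

/-- The characters as elements of `L²`. -/
def characterLp (n : LatticePoint d) : WaveSpace d :=
  BoundedContinuousFunction.toLp 2 (brillouinMeasure d) ℂ (character n)

theorem coeFn_characterLp (n : LatticePoint d) :
    characterLp n =ᵐ[brillouinMeasure d] character n :=
  BoundedContinuousFunction.coeFn_toLp 2 (brillouinMeasure d) ℂ (character n)

theorem orthonormal_characterLp : Orthonormal ℂ (characterLp (d := d)) := by
  rw [orthonormal_iff_ite]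
  intro n m
  have e : ⟪characterLp n, characterLp m⟫_ℂ =
      ∫ k, Complex.exp (Complex.I * (phase k (n - m) : ℂ)) ∂brillouinMeasure d := by
    rw [L2.inner_def]
    refine integral_congr_ae ?_
    filter_upwards [coeFn_characterLp n, coeFn_characterLp m] with k h1 h2
    rw [h1, h2, RCLike.inner_apply, conj_character, character_apply, ← Complex.exp_add, phase_sub]
    congr 1
    push_cast
    ring
  rw [e, integral_exp_phase]
  simp only [sub_eq_zero]

/-- The wave vector as a point of the torus (with reversed orientation). -/
def toTorus (k : Space d) : UnitAddTorus (Fin d) := fun j => ((-(k j / (2 * Real.pi)) : ℝ) : UnitAddCircle)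

/-- A section of `toTorus`. -/
def ofTorus (θ : UnitAddTorus (Fin d)) : Space d :=
  WithLp.toLp 2 fun j => -(2 * Real.pi) * (AddCircle.measurableEquivIoc 1 (-(1 / 2)) (θ j) : ℝ)

theorem continuous_toTorus : Continuous (toTorus (d := d)) := by
  refine continuous_pi fun j => ?_
  exact (AddCircle.continuous_mk' 1).comp (by fun_prop)

theorem measurable_ofTorus : Measurable (ofTorus (d := d)) := by
  refine (MeasurableEquiv.toLp 2 (Fin d → ℝ)).measurable.comp (measurable_pi_lambda _ fun j => ?_)
  exact ((measurable_subtype_coe.comp (MeasurableEquiv.measurable _)).comp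
    (measurable_pi_apply j)).const_mul _

theorem ofTorus_toTorus {k : Space d} (hk : ∀ j, k j ∈ Set.Ico (-Real.pi) Real.pi) :
    ofTorus (toTorus k) = k := by
  ext j
  have hpi := Real.pi_pos
  -- The sign reversal sends `[-π, π)` to `(-1/2, 1/2]`, the fundamental domain used by `equivIoc`.
  have hm : -(k j / (2 * Real.pi)) ∈ Set.Ioc (-(1 / 2) : ℝ) (-(1 / 2) + 1) := by
    obtain ⟨h1, h2⟩ := hk j
    constructor
    · rw [neg_lt_neg_iff, div_lt_iff₀ (by positivity)]
      linarith
    · rw [neg_le, le_div_iff₀ (by positivity)]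
      linarith
  have h := AddCircle.equivIoc_coe_eq (p := (1 : ℝ)) hm
  change -(2 * Real.pi) * (AddCircle.equivIoc 1 (-(1 / 2)) ((-(k j / (2 * Real.pi)) : ℝ) : UnitAddCircle) : ℝ) = k j
  rw [h]
  field_simp

theorem mFourier_toTorus (n : LatticePoint d) (k : Space d) :
    UnitAddTorus.mFourier n (toTorus k) = character n k := by
  change ∏ j, fourier (n j) ((-(k j / (2 * Real.pi)) : ℝ) : UnitAddCircle) = _
  simp only [fourier_coe_apply]
  rw [← Complex.exp_sum, character_apply, phase]
  congr 1
  have hpi : (Real.pi : ℂ) ≠ 0 := by exact_mod_cast Real.pi_ne_zero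
  push_cast
  rw [Finset.mul_sum, ← Finset.sum_neg_distrib]
  refine Finset.sum_congr rfl fun j _ => ?_
  field_simp

/-- Trigonometric polynomials are dense in `C(𝕋^d)`, and `C(𝕋^d)` is dense in `L²(ν)` for the image
measure `ν`. Pulling back to the zone is a surjection of `L²` spaces, because `toTorus` has an
almost everywhere inverse. Images of dense subspaces under maps with dense range remain dense, so
`ν` never has to be identified with Haar measure. -/
theorem span_characterLp :
    (Submodule.span ℂ (Set.range (characterLp (d := d)))).topologicalClosure = ⊤ := by
  set μ := brillouinMeasure d
  set ν : Measure (UnitAddTorus (Fin d)) := μ.map toTorus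
  have hπ : MeasurePreserving toTorus μ ν := continuous_toTorus.measurable.measurePreserving μ
  have hae : ofTorus ∘ toTorus =ᵐ[μ] id := ae_mem_Ico.mono fun k hk => ofTorus_toTorus hk
  have hs : MeasurePreserving ofTorus ν μ := by
    refine ⟨measurable_ofTorus, ?_⟩
    rw [Measure.map_map measurable_ofTorus continuous_toTorus.measurable, Measure.map_congr hae,
      Measure.map_id]
  have : IsFiniteMeasure ν := Measure.isFiniteMeasure_map μ _
  have h1 := (ContinuousMap.toLp_denseRange (p := 2) ℂ ν ℂ
    ENNReal.ofNat_ne_top).topologicalClosure_map_submodule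
    (UnitAddTorus.span_mFourier_closure_eq_top (d := Fin d))
  set P := (Lp.compMeasurePreservingₗᵢ (E := ℂ) (p := 2) ℂ toTorus hπ).toContinuousLinearMap
  -- A preimage of `G` is its pullback along the section `ofTorus`.
  have hP : Function.Surjective P := fun G => by
    refine ⟨Lp.compMeasurePreserving ofTorus hs G, ?_⟩
    refine Lp.ext ?_
    refine (Lp.coeFn_compMeasurePreserving _ hπ).trans ?_
    refine (hπ.quasiMeasurePreserving.ae_eq (Lp.coeFn_compMeasurePreserving G hs)).trans ?_
    filter_upwards [hae] with k hk
    exact congrArg G hk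
  have h2 := hP.denseRange.topologicalClosure_map_submodule h1
  rw [← h2]
  congr 1
  rw [Submodule.map_span, Submodule.map_span, ← Set.range_comp, ← Set.range_comp]
  congr 2
  ext1 n
  refine Lp.ext ?_
  refine (coeFn_characterLp n).trans (EventuallyEq.symm ?_)
  refine (Lp.coeFn_compMeasurePreserving _ hπ).trans ?_
  refine (hπ.quasiMeasurePreserving.ae_eq (ContinuousMap.coeFn_toLp ν _)).trans ?_
  exact Eventually.of_forall fun k => mFourier_toTorus n k

/-- The Hilbert basis of characters. -/
def characterBasis (d : ℕ) : HilbertBasis (LatticePoint d) ℂ (WaveSpace d) :=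
  HilbertBasis.mk orthonormal_characterLp span_characterLp.ge

theorem characterBasis_apply (n : LatticePoint d) : characterBasis d n = characterLp n := by
  rw [characterBasis, HilbertBasis.coe_mk]

/-- With basis vectors `e^{-ik·n}` the coordinates carry `e^{+ik·n}`. This is the sign for which the
matrix elements of a multiplier are the kernel `∫ m(k) e^{ik·(n-n')}` in `IsMultiplierImage`. -/
theorem characterBasis_repr (G : WaveSpace d) (n : LatticePoint d) :
    (characterBasis d).repr G n =
      ∫ k, Complex.exp (Complex.I * (phase k n : ℂ)) * G k ∂brillouinMeasure d := by
  rw [HilbertBasis.repr_apply_apply, characterBasis_apply, L2.inner_def]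
  refine integral_congr_ae ?_
  filter_upwards [coeFn_characterLp n] with k hk
  rw [hk, RCLike.inner_apply, conj_character, mul_comm]

end Fourier

/-! ### Multipliers in the wave vector representation -/

section Multiplier

variable {d : ℕ}

theorem memLp_mul (F : Space d →ᵇ ℂ) (G : WaveSpace d) :
    MemLp (fun k => F k * G k) 2 (brillouinMeasure d) :=
  (Lp.memLp G).of_le_mul (c := ‖F‖)
    (F.continuous.aestronglyMeasurable.mul (Lp.aestronglyMeasurable G))
    (Eventually.of_forall fun k => by
      rw [norm_mul]
      gcongr
      exact F.norm_coe_le_norm k)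

/-- Multiplication by a bounded continuous function of the wave vector. -/
def waveMul (F : Space d →ᵇ ℂ) : WaveSpace d →L[ℂ] WaveSpace d :=
  LinearMap.mkContinuous
    { toFun := fun G => (memLp_mul F G).toLp
      map_add' := fun G K => by
        refine Lp.ext ?_
        filter_upwards [(memLp_mul F (G + K)).coeFn_toLp, (memLp_mul F G).coeFn_toLp,
          (memLp_mul F K).coeFn_toLp, Lp.coeFn_add G K,
          Lp.coeFn_add (memLp_mul F G).toLp (memLp_mul F K).toLp] with k h1 h2 h3 h4 h5
        rw [h1, h5, Pi.add_apply, h2, h3, h4, Pi.add_apply, mul_add]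
      map_smul' := fun c G => by
        refine Lp.ext ?_
        filter_upwards [(memLp_mul F (c • G)).coeFn_toLp, (memLp_mul F G).coeFn_toLp,
          Lp.coeFn_smul c G, Lp.coeFn_smul c (memLp_mul F G).toLp] with k h1 h2 h3 h4
        rw [h1, RingHom.id_apply, h4, Pi.smul_apply, h2, h3, Pi.smul_apply, mul_smul_comm] } ‖F‖ <|
    fun G => by
      refine Lp.norm_le_mul_norm_of_ae_le_mul ?_
      filter_upwards [(memLp_mul F G).coeFn_toLp] with k h1
      change ‖(memLp_mul F G).toLp _ k‖ ≤ _
      rw [h1, norm_mul]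
      gcongr
      exact F.norm_coe_le_norm k

theorem coeFn_waveMul (F : Space d →ᵇ ℂ) (G : WaveSpace d) :
    waveMul F G =ᵐ[brillouinMeasure d] fun k => F k * G k :=
  (memLp_mul F G).coeFn_toLp

theorem norm_waveMul_le (F : Space d →ᵇ ℂ) : ‖waveMul F‖ ≤ ‖F‖ :=
  LinearMap.mkContinuous_norm_le _ (norm_nonneg _) _

/-- Multiplication by functions of the wave vector is a representation. -/
def waveMulHom (d : ℕ) : (Space d →ᵇ ℂ) →ₐ[ℂ] (WaveSpace d →L[ℂ] WaveSpace d) :=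
  AlgHom.ofLinearMap
    { toFun := waveMul
      map_add' := fun F K => by
        ext1 G
        refine Lp.ext ?_
        filter_upwards [coeFn_waveMul (F + K) G, coeFn_waveMul F G, coeFn_waveMul K G,
          Lp.coeFn_add (waveMul F G) (waveMul K G)] with k h1 h2 h3 h4
        refine h1.trans (Eq.trans ?_ h4.symm)
        rw [Pi.add_apply, h2, h3, BoundedContinuousFunction.add_apply, add_mul]
      map_smul' := fun c F => by
        ext1 G
        refine Lp.ext ?_
        filter_upwards [coeFn_waveMul (c • F) G, coeFn_waveMul F G,
          Lp.coeFn_smul c (waveMul F G)] with k h1 h2 h3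
        refine h1.trans (Eq.trans ?_ h3.symm)
        rw [Pi.smul_apply, h2, BoundedContinuousFunction.smul_apply, smul_eq_mul, smul_eq_mul,
          mul_assoc] }
    (by
      ext1 G
      refine Lp.ext ?_
      filter_upwards [coeFn_waveMul 1 G] with k h1
      refine h1.trans ?_
      simp)
    (fun F K => by
      ext1 G
      refine Lp.ext ?_
      filter_upwards [coeFn_waveMul (F * K) G, coeFn_waveMul F (waveMul K G),
        coeFn_waveMul K G] with k h1 h2 h3
      refine h1.trans ?_
      refine Eq.trans ?_ h2.symm
      rw [h3, BoundedContinuousFunction.mul_apply, mul_assoc])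

/-- The operator with symbol `F` on the one-particle space. -/
def multiplier (d : ℕ) : (Space d →ᵇ ℂ) →ₐ[ℂ] (OneParticle d →L[ℂ] OneParticle d) :=
  AlgHom.ofLinearMap
    { toFun := fun F => ((characterBasis d).repr : WaveSpace d →L[ℂ] OneParticle d) ∘L
        waveMulHom d F ∘L ((characterBasis d).repr.symm : OneParticle d →L[ℂ] WaveSpace d)
      map_add' := fun A B => by
        ext1 u
        simp
      map_smul' := fun c A => by
        ext1 u
        simp }
    (by
      ext1 u
      simp)
    (fun A B => by
      ext1 u
      simp)

theorem multiplier_apply (F : Space d →ᵇ ℂ) (u : OneParticle d) :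
    multiplier d F u = (characterBasis d).repr (waveMul F ((characterBasis d).repr.symm u)) := rfl

theorem norm_multiplier_le (F : Space d →ᵇ ℂ) : ‖multiplier d F‖ ≤ ‖F‖ := by
  refine ContinuousLinearMap.opNorm_le_bound _ (norm_nonneg _) fun u => ?_
  rw [multiplier_apply, LinearIsometryEquiv.norm_map]
  refine ((waveMul F).le_of_opNorm_le (norm_waveMul_le F) _).trans_eq ?_
  rw [LinearIsometryEquiv.norm_map]

theorem inner_multiplier (F : Space d →ᵇ ℂ) (G K : WaveSpace d) :
    ⟪(characterBasis d).repr G, multiplier d F ((characterBasis d).repr K)⟫_ℂ =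
      ∫ k, starRingEnd ℂ (G k) * (F k * K k) ∂brillouinMeasure d := by
  rw [multiplier_apply, LinearIsometryEquiv.symm_apply_apply, LinearIsometryEquiv.inner_map_map,
    L2.inner_def]
  refine integral_congr_ae ?_
  filter_upwards [coeFn_waveMul F K] with k hk
  rw [hk, RCLike.inner_apply, mul_comm]

/-- Convolution with the Fourier coefficients of the symbol is Parseval's identity for the pairing
of `F̄ e_n` with the wave function of `u`. Only values on the zone matter, so an unbounded symbol
may be replaced by any bounded continuous function agreeing with it there. -/
theorem multiplier_eq_of_isMultiplierImage {m : Space d → ℝ} {u v : OneParticle d}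
    (h : IsMultiplierImage m u v) (F : Space d →ᵇ ℂ) (hF : ∀ k ∈ brillouin d, F k = m k) :
    v = multiplier d F u := by
  ext n
  rw [h n, ← inner_site n (multiplier d F u)]
  obtain ⟨K, rfl⟩ := (characterBasis d).repr.surjective u
  have hs : site n = (characterBasis d).repr (characterLp n) := by
    rw [← characterBasis_apply, HilbertBasis.repr_self]
    rfl
  have e1 : ∀ k, starRingEnd ℂ (starRingEnd ℂ (F k) * character n k) =
      F k * starRingEnd ℂ (character n k) := fun k => by simp
  -- The symbol is moved, conjugated, to the left slot: its product with a character is expanded in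
  -- the basis, while `K` stays arbitrary.
  have e2 : ⟪site n, multiplier d F ((characterBasis d).repr K)⟫_ℂ =
      ⟪waveMul (star F) (characterLp n), K⟫_ℂ := by
    rw [hs, inner_multiplier, L2.inner_def]
    refine integral_congr_ae ?_
    filter_upwards [coeFn_waveMul (star F) (characterLp n), coeFn_characterLp n] with k h1 h2
    rw [h1, RCLike.inner_apply, h2, BoundedContinuousFunction.star_apply, RCLike.star_def, e1]
    ring
  rw [e2, ← ((characterBasis d).hasSum_inner_mul_inner _ K).tsum_eq]
  refine tsum_congr fun n' => ?_
  rw [← HilbertBasis.repr_apply_apply]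
  congr 1
  rw [← integral_brillouinMeasure, characterBasis_apply, L2.inner_def]
  refine integral_congr_ae ?_
  filter_upwards [coeFn_waveMul (star F) (characterLp n), coeFn_characterLp n,
    coeFn_characterLp n', ae_mem_brillouin] with k h1 h2 h3 h4
  rw [h1, h3, RCLike.inner_apply, h2, BoundedContinuousFunction.star_apply, RCLike.star_def, e1,
    conj_character, character_apply, hF k h4, phase_sub]
  have e3 : Complex.exp (Complex.I * ((phase k n - phase k n' : ℝ) : ℂ)) =
      Complex.exp (Complex.I * (phase k n : ℂ)) *
        Complex.exp (-(Complex.I * (phase k n' : ℂ))) := by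
    rw [← Complex.exp_add]
    congr 1
    push_cast
    ring
  rw [e3]
  ring

end Multiplier

/-! ### Strong convergence of functional calculi -/

section StrongConvergence

variable {d : ℕ}

/-- The resolvent function `x ↦ (x_j - z)⁻¹` for non-real `z`. -/
def resolventFun (j : Fin d) (z : ℂ) (hz : z.im ≠ 0) : Space d →ᵇ ℂ :=
  BoundedContinuousFunction.ofNormedAddCommGroup (fun x => ((x j : ℂ) - z)⁻¹)
    (by
      refine Continuous.inv₀ (by fun_prop) fun x h => hz ?_
      have := congrArg Complex.im h
      simpa using this) |z.im|⁻¹ fun x => by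
    rw [norm_inv]
    refine inv_anti₀ (abs_pos.2 hz) ?_
    have := Complex.abs_im_le_norm ((x j : ℂ) - z)
    simpa using this

theorem resolventFun_apply (j : Fin d) (z : ℂ) (hz : z.im ≠ 0) (x : Space d) :
    resolventFun j z hz x = ((x j : ℂ) - z)⁻¹ := rfl

/-- The values at `i` of the resolvents of the coordinates. -/
def resolventPoint (x : Space d) : Fin d → ℂ := fun j => ((x j : ℂ) - Complex.I)⁻¹

/-- A product of circles, the closure of the values of `resolventPoint`. -/
def resolventCompact (d : ℕ) : Set (Fin d → ℂ) := {b | ∀ j, ‖b j‖ ^ 2 = (b j).im}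

/-- For `w = (x - i)⁻¹` with `x` real, `|w|² = Im w = 1/(1 + x²)`. Each coordinate line thus becomes
a circle with the point `0` removed, and `0` plays the role of infinity. -/
theorem resolventPoint_mem (x : Space d) : resolventPoint x ∈ resolventCompact d := fun j => by
  rw [resolventPoint, norm_inv, Complex.inv_im, inv_pow, ← Complex.normSq_eq_norm_sq]
  simp

theorem isCompact_resolventCompact : IsCompact (resolventCompact d) := by
  refine Metric.isCompact_of_isClosed_isBounded ?_ ?_
  · rw [resolventCompact, Set.ofPred_forall]
    exact isClosed_iInter fun j => isClosed_eq (by fun_prop) (by fun_prop)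
  · refine (Metric.isBounded_closedBall (x := 0) (r := 1)).subset fun b hb => ?_
    rw [mem_closedBall_zero_iff, pi_norm_le_iff_of_nonneg zero_le_one]
    intro j
    have h1 := hb j
    have h2 := (le_abs_self _).trans (Complex.abs_im_le_norm (b j))
    nlinarith [norm_nonneg (b j)]

instance : CompactSpace (resolventCompact d) :=
  isCompact_iff_compactSpace.1 isCompact_resolventCompact

theorem continuous_resolventCompact_coord (j : Fin d) :
    Continuous fun b : resolventCompact d => b.1 j :=
  (continuous_apply j).comp continuous_subtype_val

/-- The original point is recovered as `x_j = Re (1/b_j)`. Near a point with some `b_j = 0` this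
coordinate is large or undefined, hence outside the support, and extension by zero is continuous. -/
theorem exists_extension_of_hasCompactSupport {F : Space d → ℂ} (hF : Continuous F)
    (hFc : HasCompactSupport F) :
    ∃ G : C(resolventCompact d, ℂ), ∀ x, G ⟨resolventPoint x, resolventPoint_mem x⟩ = F x := by
  classical
  set X : (Fin d → ℂ) → Space d := fun b => WithLp.toLp 2 fun j => ((b j)⁻¹).re with hX
  have hX0 : ∀ x, X (resolventPoint x) = x := fun x => by
    ext j
    change (((x j : ℂ) - Complex.I)⁻¹⁻¹).re = x j
    rw [inv_inv]
    simp
  have hne : ∀ x j, resolventPoint (d := d) x j ≠ 0 := fun x j => by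
    refine inv_ne_zero fun h => ?_
    have := congrArg Complex.im h
    simp at this
  obtain ⟨R, hR⟩ := hFc.isCompact.isBounded.exists_norm_le
  refine ⟨⟨fun b => if ∀ j, b.1 j ≠ 0 then F (X b.1) else 0, ?_⟩, fun x => ?_⟩
  · rw [continuous_iff_continuousAt]
    rintro ⟨b, hb⟩
    by_cases h0 : ∀ j, b j ≠ 0
    · have hev : ∀ᶠ b' : resolventCompact d in 𝓝 ⟨b, hb⟩, ∀ j, b'.1 j ≠ 0 := by
        rw [eventually_all]
        intro j
        exact (continuous_resolventCompact_coord j).continuousAt.eventually_ne (h0 j)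
      have hc : ContinuousAt (fun b' : resolventCompact d => F (X b'.1)) ⟨b, hb⟩ := by
        refine hF.continuousAt.comp ?_
        refine (PiLp.continuous_toLp 2 _).continuousAt.comp ?_
        refine continuousAt_pi.2 fun j => Complex.continuous_re.continuousAt.comp ?_
        exact (continuous_resolventCompact_coord j).continuousAt.inv₀ (h0 j)
      refine hc.congr ?_
      filter_upwards [hev] with b' hb'
      rw [if_pos hb']
    · obtain ⟨j, hj⟩ := not_forall.1 h0
      rw [not_not] at hj
      have hc : Continuous fun b' : resolventCompact d => ‖b'.1 j‖ ^ 2 * (1 + R ^ 2) :=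
        ((continuous_resolventCompact_coord j).norm.pow 2).mul continuous_const
      -- On the circle `|b_j|² = 1/(1 + x_j²)` for `b_j ≠ 0`, so this inequality says `x_j² > R²`.
      have hev : ∀ᶠ b' : resolventCompact d in 𝓝 ⟨b, hb⟩, ‖b'.1 j‖ ^ 2 * (1 + R ^ 2) < 1 := by
        refine hc.continuousAt.eventually_lt continuousAt_const ?_
        simp [hj]
      have hz : (fun b' : resolventCompact d => if ∀ j, b'.1 j ≠ 0 then F (X b'.1) else 0) =ᶠ[
          𝓝 ⟨b, hb⟩] fun _ => 0 := by
        filter_upwards [hev] with b' hb'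
        split_ifs with h1
        · by_contra hFX
          have h2 := hR _ (subset_tsupport _ hFX)
          have h3 : |((b'.1 j)⁻¹).re| ≤ R := (PiLp.norm_apply_le (X b'.1) j).trans h2
          have h4 := b'.2 j
          rw [Complex.inv_re, Complex.normSq_eq_norm_sq] at h3
          have h5 : (0 : ℝ) < ‖b'.1 j‖ ^ 2 := by
            have := norm_pos_iff.2 (h1 j)
            positivity
          rw [abs_div, abs_of_pos h5, div_le_iff₀ h5] at h3
          have h6 := sq_abs (b'.1 j).re
          have h7 : ‖b'.1 j‖ ^ 2 = (b'.1 j).re ^ 2 + (b'.1 j).im ^ 2 := by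
            rw [← Complex.normSq_eq_norm_sq, Complex.normSq_apply]
            ring
          have h8 : |(b'.1 j).re| ^ 2 ≤ (R * ‖b'.1 j‖ ^ 2) ^ 2 :=
            pow_le_pow_left₀ (abs_nonneg _) h3 2
          rw [h6] at h8
          rw [← h4] at h7
          nlinarith
        · rfl
      exact (continuousAt_const (y := (0 : ℂ))).congr hz.symm
  · change (if ∀ j, resolventPoint x j ≠ 0 then F (X (resolventPoint x)) else 0) = F x
    rw [if_pos (hne x), hX0]

/-- Functions on the compactification as bounded functions on macroscopic space. -/
def resolventPullback (d : ℕ) : C(resolventCompact d, ℂ) →ₐ[ℂ] (Space d →ᵇ ℂ) where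
  toFun G := BoundedContinuousFunction.ofNormedAddCommGroup
    (fun x => G ⟨resolventPoint x, resolventPoint_mem x⟩)
    (G.continuous.comp (Continuous.subtype_mk
      (continuous_pi fun j => (resolventFun j Complex.I (by simp)).continuous) _)) ‖G‖
    fun x => G.norm_coe_le_norm _
  map_one' := rfl
  map_mul' _ _ := rfl
  map_zero' := rfl
  map_add' _ _ := rfl
  commutes' _ := rfl

/-- The coordinate functions on the compactification. -/
def resolventCoord (j : Fin d) : C(resolventCompact d, ℂ) := 
  ⟨fun b => b.1 j, continuous_resolventCompact_coord j⟩

/-- Stone–Weierstrass on the compactification: the coordinates `b_j` separate points, so polynomials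
in them and their conjugates approximate the continuous extension of `F`. The coordinates pull back
to the resolvents at `i`, their conjugates to those at `-i`. -/
theorem exists_adjoin_near_of_hasCompactSupport (F : Space d →ᵇ ℂ) (hFc : HasCompactSupport F)
    {δ : ℝ} (hδ : 0 < δ) :
    ∃ P ∈ Algebra.adjoin ℂ (Set.range (fun j : Fin d => resolventFun j Complex.I (by simp)) ∪
      Set.range fun j : Fin d => resolventFun j (-Complex.I) (by simp)), ‖P - F‖ ≤ δ := by
  obtain ⟨G, hG⟩ := exists_extension_of_hasCompactSupport F.continuous hFc
  have hsw := ContinuousMap.starSubalgebra_topologicalClosure_eq_top_of_separatesPoints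
    (StarAlgebra.adjoin ℂ (Set.range (resolventCoord (d := d)))) (by
      intro b b' hbb
      obtain ⟨j, hj⟩ := Function.ne_iff.1 (Subtype.coe_injective.ne hbb)
      exact ⟨_, ⟨_, StarAlgebra.subset_adjoin ℂ _ ⟨j, rfl⟩, rfl⟩, hj⟩)
  have hmem : G ∈ (StarAlgebra.adjoin ℂ (Set.range (resolventCoord (d := d)))).topologicalClosure := by
    rw [hsw]
    trivial
  obtain ⟨P, hP, hPG⟩ := Metric.mem_closure_iff.1 hmem δ hδ
  refine ⟨resolventPullback d P, ?_, ?_⟩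
  · have hP' : P ∈ (StarAlgebra.adjoin ℂ (Set.range (resolventCoord (d := d)))).toSubalgebra := hP
    rw [StarAlgebra.adjoin_toSubalgebra] at hP'
    have h1 : resolventPullback d P ∈ (Algebra.adjoin ℂ (Set.range (resolventCoord (d := d)) ∪
      star (Set.range (resolventCoord (d := d))))).map (resolventPullback d) := ⟨P, hP', rfl⟩
    rw [AlgHom.map_adjoin] at h1
    refine Algebra.adjoin_mono ?_ h1
    rintro _ ⟨Q, hQ | ⟨j, hj⟩, rfl⟩
    · obtain ⟨j, rfl⟩ := hQ
      left
      refine ⟨j, ?_⟩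
      ext x
      rfl
    · right
      refine ⟨j, ?_⟩
      ext x
      have e : Q = star (resolventCoord j) := by rw [hj, star_star]
      change _ = Q _
      rw [e]
      change ((x j : ℂ) - -Complex.I)⁻¹ = starRingEnd ℂ (((x j : ℂ) - Complex.I)⁻¹)
      simp
  · refine (BoundedContinuousFunction.norm_le hδ.le).2 fun x => ?_
    change ‖P _ - F x‖ ≤ δ
    rw [← hG x, ← dist_eq_norm, dist_comm]
    exact (ContinuousMap.dist_apply_le_dist _).trans hPG.le

variable {E ι : Type*} [NormedAddCommGroup E] [NormedSpace ℂ E]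

/-- The functions whose functional calculus converges strongly. -/
def strongLimitSubalgebra (l : Filter ι) (Φ : ι → (Space d →ᵇ ℂ) →ₐ[ℂ] (E →L[ℂ] E))
    (Φ₀ : (Space d →ᵇ ℂ) →ₐ[ℂ] (E →L[ℂ] E)) (hΦ : ∀ i F, ‖Φ i F‖ ≤ ‖F‖) :
    Subalgebra ℂ (Space d →ᵇ ℂ) where
  carrier := {F | ∀ u, Tendsto (fun i => Φ i F u) l (𝓝 (Φ₀ F u))}
  mul_mem' := by
    intro F G hF hG u
    simp only [map_mul]
    -- Products converge strongly because `Φ i F` is bounded uniformly in `i`: the error made in the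
    -- inner factor is not amplified.
    have h1 : Tendsto (fun i => Φ i F (Φ i G u - Φ₀ G u)) l (𝓝 0) := by
      have h2 := ((hG u).sub_const (Φ₀ G u)).norm.const_mul ‖F‖
      rw [sub_self, norm_zero, mul_zero] at h2
      exact squeeze_zero_norm (fun i => (Φ i F).le_of_opNorm_le (hΦ i F) _) h2
    have h3 := h1.add (hF (Φ₀ G u))
    simp only [map_sub, sub_add_cancel, zero_add] at h3
    exact h3
  add_mem' := by
    intro F G hF hG u
    simp only [map_add]
    exact (hF u).add (hG u)
  algebraMap_mem' := by
    intro c u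
    simp only [AlgHom.commutes]
    exact tendsto_const_nhds

/-- The functions with strongly convergent calculus form an algebra. If it contains the resolvents
at `±i`, it approximates `F` uniformly; contractivity of all the calculi then closes a three-term
estimate. -/
theorem tendsto_of_tendsto_resolvent (l : Filter ι) (Φ : ι → (Space d →ᵇ ℂ) →ₐ[ℂ] (E →L[ℂ] E))
    (Φ₀ : (Space d →ᵇ ℂ) →ₐ[ℂ] (E →L[ℂ] E)) (hΦ : ∀ i F, ‖Φ i F‖ ≤ ‖F‖)
    (hΦ₀ : ∀ F, ‖Φ₀ F‖ ≤ ‖F‖)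
    (hres : ∀ (j : Fin d) (z : ℂ) (hz : z.im ≠ 0) (u : E),
      Tendsto (fun i => Φ i (resolventFun j z hz) u) l (𝓝 (Φ₀ (resolventFun j z hz) u)))
    (F : Space d →ᵇ ℂ) (hFc : HasCompactSupport F) (u : E) :
    Tendsto (fun i => Φ i F u) l (𝓝 (Φ₀ F u)) := by
  rw [Metric.tendsto_nhds]
  intro δ hδ
  obtain ⟨P, hP, hPF⟩ := exists_adjoin_near_of_hasCompactSupport F hFc
    (δ := δ / (3 * (‖u‖ + 1))) (by positivity)
  have hP' : P ∈ strongLimitSubalgebra l Φ Φ₀ hΦ := by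
    refine Algebra.adjoin_le ?_ hP
    rintro _ (⟨j, rfl⟩ | ⟨j, rfl⟩)
    · exact hres j _ _
    · exact hres j _ _
  have hb : ‖P - F‖ * ‖u‖ ≤ δ / 3 := by
    refine (mul_le_mul_of_nonneg_right hPF (norm_nonneg u)).trans ?_
    rw [div_mul_eq_mul_div, div_le_div_iff₀ (by positivity) (by positivity)]
    nlinarith [norm_nonneg u]
  filter_upwards [Metric.tendsto_nhds.1 (hP' u) (δ / 3) (by positivity)] with i hi
  have h1 : ‖Φ i P u - Φ i F u‖ ≤ δ / 3 := by
    rw [← _root_.sub_apply, ← map_sub]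
    exact ((Φ i _).le_of_opNorm_le (hΦ i _) u).trans hb
  have h2 : ‖Φ₀ P u - Φ₀ F u‖ ≤ δ / 3 := by
    rw [← _root_.sub_apply, ← map_sub]
    exact ((Φ₀ _).le_of_opNorm_le (hΦ₀ _) u).trans hb
  rw [← dist_eq_norm] at h1 h2
  have h3 := dist_triangle4 (Φ i F u) (Φ i P u) (Φ₀ P u) (Φ₀ F u)
  rw [dist_comm] at h1
  linarith

end StrongConvergence

/-! ### Propagation of functions of the position operator -/

section Propagation

variable {d : ℕ}

theorem multiplier_congr {F G : Space d →ᵇ ℂ} (h : ∀ k ∈ brillouin d, F k = G k) :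
    multiplier d F = multiplier d G := by
  ext1 u
  rw [multiplier_apply, multiplier_apply]
  congr 1
  refine Lp.ext ?_
  filter_upwards [coeFn_waveMul F ((characterBasis d).repr.symm u),
    coeFn_waveMul G ((characterBasis d).repr.symm u), ae_mem_brillouin] with k h1 h2 h3
  rw [h1, h2, h k h3]

/-- Composition of bounded functions with a continuous map. -/
def pullback (ρ : C(Space d, Space d)) : (Space d →ᵇ ℂ) →ₐ[ℂ] (Space d →ᵇ ℂ) where
  toFun F := F.compContinuous ρ
  map_one' := rfl
  map_mul' _ _ := rfl
  map_zero' := rfl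
  map_add' _ _ := rfl
  commutes' _ := rfl

theorem norm_pullback_le (ρ : C(Space d, Space d)) (F : Space d →ᵇ ℂ) : ‖pullback ρ F‖ ≤ ‖F‖ :=
  (BoundedContinuousFunction.norm_le (norm_nonneg _)).2 fun k => F.norm_coe_le_norm (ρ k)

theorem tendsto_apply_of_dense {E ι : Type*} [NormedAddCommGroup E] [NormedSpace ℂ E]
    {l : Filter ι} {A : ι → E →L[ℂ] E} {A₀ : E →L[ℂ] E} {C : ℝ} (hA : ∀ i, ‖A i‖ ≤ C)
    {S : Set E} (hS : Dense S) (h : ∀ u ∈ S, Tendsto (fun i => A i u) l (𝓝 (A₀ u))) (u : E) :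
    Tendsto (fun i => A i u) l (𝓝 (A₀ u)) := by
  rw [Metric.tendsto_nhds]
  intro δ hδ
  set M := max C ‖A₀‖
  have hM0 : 0 ≤ M := (norm_nonneg A₀).trans (le_max_right _ _)
  obtain ⟨w, hw, huw⟩ := hS.exists_dist_lt u (ε := δ / (3 * (M + 1))) (by positivity)
  have hb : M * ‖w - u‖ ≤ δ / 3 := by
    rw [← dist_eq_norm, dist_comm]
    refine (mul_le_mul_of_nonneg_left huw.le hM0).trans ?_
    rw [mul_div_assoc', div_le_div_iff₀ (by positivity) (by positivity)]
    nlinarith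
  filter_upwards [Metric.tendsto_nhds.1 (h w hw) (δ / 3) (by positivity)] with i hi
  have h1 : dist (A i w) (A i u) ≤ δ / 3 := by
    rw [dist_eq_norm, ← map_sub]
    exact ((A i).le_of_opNorm_le ((hA i).trans (le_max_left _ _)) _).trans hb
  have h2 : dist (A₀ w) (A₀ u) ≤ δ / 3 := by
    rw [dist_eq_norm, ← map_sub]
    exact (A₀.le_of_opNorm_le (le_max_right _ _) _).trans hb
  have h3 := dist_triangle4 (A i u) (A i w) (A₀ w) (A₀ u)
  rw [dist_comm] at h1
  linarith

/-- Functions of the rescaled Heisenberg position operators, seen from the lattice point `y`. -/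
def heisenberg (H : selfAdjoint (OneParticle d →L[ℂ] OneParticle d)) (ε t : ℝ)
    (y : LatticePoint d) : (Space d →ᵇ ℂ) →ₐ[ℂ] (OneParticle d →L[ℂ] OneParticle d) :=
  ((conjHom (translation y).symm).comp (conjHom (evolution H (t / ε)))).comp (diagonalHom ε)

theorem heisenberg_apply (H : selfAdjoint (OneParticle d →L[ℂ] OneParticle d)) (ε t : ℝ)
    (y : LatticePoint d) (F : Space d →ᵇ ℂ) (u : OneParticle d) :
    heisenberg H ε t y F u = (translation y).symm (evolution H (t / ε)
      (diagonal ε F ((evolution H (t / ε)).symm (translation y u)))) := rfl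

theorem norm_heisenberg_le (H : selfAdjoint (OneParticle d →L[ℂ] OneParticle d)) (ε t : ℝ)
    (y : LatticePoint d) (F : Space d →ᵇ ℂ) : ‖heisenberg H ε t y F‖ ≤ ‖F‖ :=
  (norm_conjHom_le _ _).trans ((norm_conjHom_le _ _).trans (norm_diagonal_le ε F))

/-- This is `(r^ε - z)⁻¹ (r^ε - z) a = a` on the natural domain, the link between the unbounded
position operator and its bounded functions. After undoing the evolution it is the cancellation of
`ε n_j - z` at each site. -/
theorem evolution_diagonal_resolventFun
    (H : selfAdjoint (OneParticle d →L[ℂ] OneParticle d)) (ε t : ℝ) (j : Fin d) (z : ℂ)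
    (hz : z.im ≠ 0) (a : OneParticle d) (ha : a ∈ (rescaledPosition H ε t j).domain) :
    evolution H (t / ε) (diagonal ε (resolventFun j z hz) ((evolution H (t / ε)).symm
      (rescaledPosition H ε t j ⟨a, ha⟩ - z • a))) = a := by
  set U := evolution H (t / ε)
  obtain ⟨b, rfl⟩ := U.surjective a
  have hb : b ∈ (position (d := d) j).domain := by
    have : U.symm (U b) ∈ (position (d := d) j).domain := ha
    rwa [U.symm_apply_apply] at this
  have e1 : rescaledPosition H ε t j ⟨U b, ha⟩ = U ((ε : ℂ) • position j ⟨b, hb⟩) := by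
    rw [map_smul]
    change (ε : ℂ) • U (position j ⟨U.symm (U b), ha⟩) = _
    congr 3
    exact Subtype.ext (U.symm_apply_apply b)
  rw [e1, map_sub, map_smul U.symm, U.symm_apply_apply, U.symm_apply_apply]
  congr 1
  ext n
  rw [diagonal_apply, resolventFun_apply]
  have hne : ((((ε • toSpace n) j : ℝ) : ℂ) - z) ≠ 0 := fun h => hz (by
    have := congrArg Complex.im h
    simpa using this)
  have e2 : ((ε : ℂ) • position j ⟨b, hb⟩ - z • b : OneParticle d) n =
      ((((ε • toSpace n) j : ℝ) : ℂ) - z) * b n := by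
    change (ε : ℂ) * (((n j : ℤ) : ℂ) * b n) - z * b n = _
    simp [toSpace]
    ring
  rw [e2, inv_mul_cancel_left₀ hne]

/-- Clamped coordinate of a continuous flow map. -/
def clampedCoord (ρ : C(Space d, Space d)) (j : Fin d) (R : ℝ) : Space d →ᵇ ℂ :=
  BoundedContinuousFunction.ofNormedAddCommGroup
    (fun k => ((max (-|R|) (min |R| (ρ k j)) : ℝ) : ℂ)) (by fun_prop) |R| fun k => by
    rw [Complex.norm_real, Real.norm_eq_abs, abs_le]
    exact ⟨le_max_left _ _, max_le (by linarith [abs_nonneg R]) (min_le_left _ _)⟩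

theorem clampedCoord_apply (ρ : C(Space d, Space d)) (j : Fin d) {R : ℝ} {k : Space d}
    (h : ‖ρ k‖ ≤ R) : clampedCoord ρ j R k = (ρ k j : ℂ) := by
  have h1 := abs_le.1 ((PiLp.norm_apply_le (ρ k) j).trans (h.trans (le_abs_self R)))
  change ((max (-|R|) (min |R| (ρ k j)) : ℝ) : ℂ) = _
  rw [min_eq_right h1.2, max_eq_right h1.1]

/-- It suffices to treat resolvents on a dense set. For `u ∈ D`, with `r` the limiting multiplier,
`(r^ε - z)⁻¹ (r - z)u - u = (r^ε - z)⁻¹ (r - r^ε)u`, which is small by the hypothesis on positions.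
The vectors `(r - z)u` are dense because `r - z` is a bounded invertible operator: its symbol is
bounded on the compact zone, and `z` is not real. -/
theorem tendsto_heisenberg {D : Submodule ℂ (OneParticle d)}
    (hD : Dense (D : Set (OneParticle d)))
    {H : ℝ → selfAdjoint (OneParticle d →L[ℂ] OneParticle d)}
    {r : ℝ → Space d → Space d → Space d} (hpos : PositionConverges D H r)
    (t : ℝ) (x : Space d) (hr : Continuous (r t x)) (F : Space d →ᵇ ℂ)
    (hF : HasCompactSupport F) (u : OneParticle d) :
    Tendsto (fun ε => heisenberg (H ε) ε t (intPart (ε⁻¹ • x)) F u) (𝓝[>] 0)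
      (𝓝 (multiplier d (pullback ⟨r t x, hr⟩ F) u)) := by
  set ρ : C(Space d, Space d) := ⟨r t x, hr⟩
  refine tendsto_of_tendsto_resolvent (𝓝[>] 0)
    (fun ε => heisenberg (H ε) ε t (intPart (ε⁻¹ • x))) ((multiplier d).comp (pullback ρ))
    (fun ε F => norm_heisenberg_le _ _ _ _ _)
    (fun F => (norm_multiplier_le _).trans (norm_pullback_le ρ F)) ?_ F hF u
  clear F hF u
  intro j z hz
  -- Clamping at this `R` makes the coordinate of the flow a bounded symbol without changing it on
  -- the zone.
  obtain ⟨R, hR⟩ := (isCompact_brillouin (d := d)).exists_bound_of_continuousOn ρ.continuous.continuousOn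
  set A : Space d →ᵇ ℂ := clampedCoord ρ j R
  have hA : ∀ k ∈ brillouin d, A k = (r t x k j : ℂ) := fun k hk => clampedCoord_apply ρ j (hR k hk)
  set B : Space d →ᵇ ℂ := A - algebraMap ℂ _ z
  have hB : ∀ k, B k = A k - z := fun k => rfl
  set P : Space d →ᵇ ℂ := pullback ρ (resolventFun j z hz)
  have hP : ∀ k ∈ brillouin d, P k * B k = 1 := fun k hk => by
    rw [hB, hA k hk]
    refine inv_mul_cancel₀ fun h => hz ?_
    have := congrArg Complex.im h
    simpa using this
  have hPB : multiplier d P * multiplier d B = 1 := by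
    rw [← map_mul, ← map_one (multiplier d)]
    exact multiplier_congr hP
  have hBP : multiplier d B * multiplier d P = 1 := by
    rw [← map_mul, mul_comm, map_mul, hPB]
  have hsurj : Function.Surjective (multiplier d B) := fun w =>
    ⟨multiplier d P w, DFunLike.congr_fun hBP w⟩
  -- The image of the dense domain `D` under the continuous surjection `r - z` is dense.
  refine tendsto_apply_of_dense (fun ε => norm_heisenberg_le _ _ _ _ _)
    (hsurj.denseRange.dense_image (multiplier d B).continuous hD) ?_
  rintro _ ⟨u, hu, rfl⟩
  obtain ⟨v, hv, hlim⟩ := hpos t x j u hu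
  have hvA : v = multiplier d A u := multiplier_eq_of_isMultiplierImage hv A hA
  have hw : multiplier d B u = v - z • u := by
    rw [hvA, map_sub, AlgHom.commutes]
    rfl
  have hlimit : ((multiplier d).comp (pullback ρ)) (resolventFun j z hz) (multiplier d B u) = u :=
    DFunLike.congr_fun hPB u
  rw [hlimit, Metric.tendsto_nhds]
  intro δ hδ
  filter_upwards [hlim (δ / (‖resolventFun j z hz‖ + 1)) (by positivity)] with ε hε
  obtain ⟨ha, hlt⟩ := hε
  set y := intPart (ε⁻¹ • x)
  set p := rescaledPosition (H ε) ε t j ⟨translate y u, ha⟩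
  have e1 := evolution_diagonal_resolventFun (H ε) ε t j z hz (translate y u) ha
  have e2 : heisenberg (H ε) ε t y (resolventFun j z hz) ((translation y).symm p - z • u) = u := by
    rw [heisenberg_apply, map_sub, map_smul, LinearIsometryEquiv.apply_symm_apply]
    exact (congrArg (translation y).symm e1).trans ((translation y).symm_apply_apply u)
  -- The resolvent identity: the error is the resolvent applied to the difference of the limiting
  -- and the rescaled position.
  have e3 : heisenberg (H ε) ε t y (resolventFun j z hz) (multiplier d B u) - u =
      heisenberg (H ε) ε t y (resolventFun j z hz) (v - (translation y).symm p) := by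
    have e : v - z • u = (v - (translation y).symm p) + ((translation y).symm p - z • u) := by abel
    rw [hw, e, map_add, e2, add_sub_cancel_right]
  rw [dist_eq_norm, e3]
  have e4 : ‖v - (translation y).symm p‖ = ‖p - translate y v‖ := by
    rw [← (translation y).norm_map, map_sub, LinearIsometryEquiv.apply_symm_apply, norm_sub_rev,
      translation_apply]
  refine ((heisenberg (H ε) ε t y _).le_of_opNorm_le (norm_heisenberg_le _ _ _ _ _) _).trans_lt ?_
  rw [e4]
  have h6 := norm_nonneg (resolventFun j z hz)
  rw [lt_div_iff₀ (by positivity)] at hlt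
  nlinarith [norm_nonneg (p - translate y v)]

end Propagation

/-! ### Analysis on macroscopic space -/

section Macroscopic

variable {d : ℕ}

open scoped FourierTransform in
-- Fourier inversion at the point `r(x,k;t)`. A smooth compactly supported `ψ` is a Schwartz
-- function, so its transform is integrable.
theorem expPosition_eq (r : ℝ → Space d → Space d → Space d) (t : ℝ) {ψ : Space d → ℂ}
    (hψ : ContDiff ℝ (⊤ : ℕ∞) ψ) (hψc : HasCompactSupport ψ) (x k : Space d) :
    expPosition r t ψ x k = ψ (r t x k) := by
  set y := r t x k
  set S := hψc.toSchwartzMap hψ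
  have hint : Integrable (𝓕 ψ) := by
    have h := (𝓕 S).integrable (μ := volume)
    rwa [SchwartzMap.fourier_coe] at h
  have hinv := hψ.continuous.fourierInv_fourier_eq (S.integrable (μ := volume)) hint
  have h1 := congrFun hinv y
  rw [Real.fourierInv_eq] at h1
  have hpi : (0 : ℝ) < 2 * Real.pi := by positivity
  have e1 : ∀ q : Space d, fourierTransform ψ q =
      (((2 * Real.pi) ^ (-(d : ℝ) / 2) : ℝ) : ℂ) * 𝓕 ψ ((2 * Real.pi)⁻¹ • q) := fun q => by
    rw [fourierTransform, Real.fourier_eq]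
    congr 1
    refine integral_congr_ae (Eventually.of_forall fun v => ?_)
    simp only [Circle.smul_def, Real.fourierChar_apply, smul_eq_mul]
    rw [mul_comm]
    congr 2
    rw [real_inner_smul_right, real_inner_comm]
    push_cast
    have : (Real.pi : ℂ) ≠ 0 := by exact_mod_cast Real.pi_ne_zero
    field_simp
  have e2 : ∀ q : Space d, fourierTransform ψ q * Complex.exp (Complex.I * ((⟪q, y⟫_ℝ : ℝ) : ℂ)) =
      (((2 * Real.pi) ^ (-(d : ℝ) / 2) : ℝ) : ℂ) *
        (fun w => Real.fourierChar ⟪w, y⟫_ℝ • 𝓕 ψ w) ((2 * Real.pi)⁻¹ • q) := fun q => by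
    rw [e1, mul_assoc]
    congr 1
    simp only [Circle.smul_def, Real.fourierChar_apply, smul_eq_mul]
    rw [mul_comm]
    congr 2
    rw [real_inner_smul_left]
    push_cast
    have : (Real.pi : ℂ) ≠ 0 := by exact_mod_cast Real.pi_ne_zero
    field_simp
  -- Passing from frequency `q` to `q/2π` gives a Jacobian `(2π)^d`, which cancels the two
  -- prefactors `(2π)^{-d/2}`.
  have e3 := Measure.integral_comp_smul (volume : Measure (Space d))
    (fun w => Real.fourierChar ⟪w, y⟫_ℝ • 𝓕 ψ w) (2 * Real.pi)⁻¹
  rw [expPosition, integral_congr_ae (Eventually.of_forall e2), integral_const_mul, e3, h1, finrank_euclideanSpace, Fintype.card_fin,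
    inv_pow, inv_inv, abs_of_pos (by positivity), Complex.real_smul, ← mul_assoc, ← mul_assoc,
    ← Complex.ofReal_mul, ← Complex.ofReal_mul, ← Real.rpow_add hpi, ← Real.rpow_natCast,
    ← Real.rpow_add hpi]
  rw [show -(d : ℝ) / 2 + -(d : ℝ) / 2 + (d : ℝ) = 0 by ring, Real.rpow_zero, Complex.ofReal_one,
    one_mul]

theorem measurable_intPart : Measurable (intPart (d := d)) :=
  measurable_pi_lambda _ fun j => Int.measurable_floor.comp (by fun_prop)

theorem intPart_add_toSpace (y : Space d) (n : LatticePoint d) :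
    intPart (y + toSpace n) = intPart y + n := by
  ext j
  simp [intPart, toSpace]

theorem norm_smul_intPart_sub_le {ε : ℝ} (hε : 0 < ε) (x : Space d) :
    ‖ε • toSpace (intPart (ε⁻¹ • x)) - x‖ ≤ ε * d := by
  have h : ∀ j, |(ε • toSpace (intPart (ε⁻¹ • x)) - x) j| ≤ ε := fun j => by
    have h1 := Int.floor_le (ε⁻¹ * x j)
    have h2 := (Int.lt_floor_add_one (ε⁻¹ * x j)).le
    have e : (ε • toSpace (intPart (ε⁻¹ • x)) - x) j = ε * (⌊ε⁻¹ * x j⌋ - ε⁻¹ * x j) := by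
      simp only [intPart, toSpace, PiLp.sub_apply, PiLp.smul_apply, smul_eq_mul, mul_sub]
      rw [mul_inv_cancel_left₀ hε.ne']
    rw [e, abs_mul, abs_of_pos hε]
    exact mul_le_of_le_one_right hε.le (abs_le.2 ⟨by linarith, by linarith⟩)
  refine (sq_le_sq₀ (norm_nonneg _) (by positivity)).1 ?_
  rw [EuclideanSpace.norm_sq_eq]
  refine (Finset.sum_le_sum fun j _ => pow_le_pow_left₀ (norm_nonneg _) (h j) 2).trans ?_
  rw [Finset.sum_const, Finset.card_univ, Fintype.card_fin, nsmul_eq_mul, mul_pow, mul_comm]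
  -- The natural bound is `ε√d`; the cruder `εd` avoids the square root.
  have hd : (d : ℝ) ≤ (d : ℝ) ^ 2 := by exact_mod_cast Nat.le_self_pow two_ne_zero d
  gcongr

theorem volume_cell {ε : ℝ} (hε : 0 < ε) (y : LatticePoint d) :
    volume {x : Space d | intPart (ε⁻¹ • x) = y} = ENNReal.ofReal (ε ^ d) := by
  have e : {x : Space d | intPart (ε⁻¹ • x) = y} = WithLp.ofLp ⁻¹' (Set.univ.pi fun j =>
      Set.Ico (ε * y j) (ε * y j + ε)) := by
    ext x
    simp only [Set.mem_ofPred_eq, Set.mem_preimage, Set.mem_univ_pi, funext_iff, intPart,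
      PiLp.smul_apply, smul_eq_mul, Int.floor_eq_iff, Set.mem_Ico]
    refine forall_congr' fun j => ?_
    rw [inv_mul_eq_div, le_div_iff₀ hε, div_lt_iff₀ hε, mul_comm ε, add_mul, one_mul]
  rw [e, (PiLp.volume_preserving_ofLp (Fin d)).measure_preimage
    (MeasurableSet.univ_pi fun _ => measurableSet_Ico).nullMeasurableSet, Real.volume_pi_Ico]
  simp only [add_sub_cancel_left, Finset.prod_const, Finset.card_univ, Fintype.card_fin,
    ENNReal.ofReal_pow hε.le]

/-- A lattice sum weighted by `ε^d` is the integral of a function constant on cells of side `ε`,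
with no discretisation error. -/
theorem integral_comp_intPart {ε : ℝ} (hε : 0 < ε) (G : LatticePoint d → ℂ)
    (S : Finset (LatticePoint d)) (hS : ∀ y, G y ≠ 0 → y ∈ S) :
    ∫ x : Space d, G (intPart (ε⁻¹ • x)) = ((ε ^ d : ℝ) : ℂ) * ∑ y ∈ S, G y := by
  have hm : ∀ y, MeasurableSet {x : Space d | intPart (ε⁻¹ • x) = y} := fun y =>
    (measurable_intPart.comp (measurable_const_smul ε⁻¹)) (measurableSet_singleton y)
  have e : ∀ x : Space d, G (intPart (ε⁻¹ • x)) =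
      ∑ y ∈ S, Set.indicator {x : Space d | intPart (ε⁻¹ • x) = y} (fun _ => G y) x := fun x => by
    simp only [Set.indicator_apply, Set.mem_ofPred_eq, Finset.sum_ite_eq]
    split_ifs with h
    · rfl
    · exact not_imp_comm.1 (hS _) h
  simp only [e]
  rw [integral_finsetSum, Finset.mul_sum]
  · refine Finset.sum_congr rfl fun y _ => ?_
    rw [integral_indicator_const _ (hm y), measureReal_def, volume_cell hε,
      ENNReal.toReal_ofReal (by positivity), Complex.real_smul]
  · intro y _
    rw [integrable_indicator_iff (hm y)]
    exact integrableOn_const (by rw [volume_cell hε]; exact ENNReal.ofReal_ne_top)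

/-- Bounded pointwise convergence gives `L¹` convergence on a ball, and translation is jointly
continuous in the function and the shift. Evaluating at moving points `x + a i` need not preserve
pointwise limits, hence the detour through `L¹`. -/
theorem tendsto_lintegral_shift {b : ℕ → Space d → ℂ} {b₀ : Space d → ℂ} {C : ℝ}
    (hb : ∀ i, Measurable (b i)) (hbC : ∀ i x, ‖b i x‖ ≤ C)
    (hlim : ∀ x, Tendsto (fun i => b i x) atTop (𝓝 (b₀ x)))
    {a : ℕ → Space d} (ha : Tendsto a atTop (𝓝 0)) (R : ℝ) :
    Tendsto (fun i => ∫⁻ x in Metric.closedBall 0 R, ‖b i (x + a i) - b₀ x‖ₑ) atTop (𝓝 0) := by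
  -- The extra unit keeps `x + a i` inside the cut-off once the shift is shorter than `1`.
  set K : Set (Space d) := Metric.closedBall 0 (R + 1)
  have hK : MeasurableSet K := Metric.isClosed_closedBall.measurableSet
  have hb₀ : Measurable b₀ := measurable_of_tendsto_metrizable hb (tendsto_pi_nhds.2 hlim)
  have hbC₀ : ∀ x, ‖b₀ x‖ ≤ C := fun x =>
    le_of_tendsto (hlim x).norm (Eventually.of_forall fun i => hbC i x)
  have hmem : ∀ c : Space d → ℂ, Measurable c → (∀ x, ‖c x‖ ≤ C) →
      MemLp (K.indicator c) 1 volume := fun c hc hcC => by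
    rw [memLp_indicator_iff_restrict hK]
    have : IsFiniteMeasure (volume.restrict K) :=
      ⟨by simpa using (isCompact_closedBall (0 : Space d) (R + 1)).measure_lt_top⟩
    exact MemLp.of_bound hc.aestronglyMeasurable C (Eventually.of_forall hcC)
  have hL1 : Tendsto (fun i => (hmem (b i) (hb i) (hbC i)).toLp) atTop
      (𝓝 (hmem b₀ hb₀ hbC₀).toLp) := by
    rw [Lp.tendsto_Lp_iff_tendsto_eLpNorm'']
    simp only [eLpNorm_one_eq_lintegral_enorm]
    have h := tendsto_lintegral_filter_of_dominated_convergence (μ := volume) (l := atTop)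
      (F := fun i x => ‖(K.indicator (b i) - K.indicator b₀) x‖ₑ) (f := fun _ => 0)
      (K.indicator fun _ => ENNReal.ofReal (2 * C)) ?_ ?_ ?_ ?_
    · simpa using h
    · exact Eventually.of_forall fun i => (((hb i).indicator hK).sub (hb₀.indicator hK)).enorm
    · refine Eventually.of_forall fun i => Eventually.of_forall fun x => ?_
      rw [Pi.sub_apply]
      by_cases hx : x ∈ K
      · simp only [Set.indicator_of_mem hx]
        rw [← ofReal_norm]
        refine ENNReal.ofReal_le_ofReal ((norm_sub_le _ _).trans ?_)
        linarith [hbC i x, hbC₀ x]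
      · simp [Set.indicator_of_notMem hx]
    · rw [lintegral_indicator_const hK]
      exact ENNReal.mul_ne_top ENNReal.ofReal_ne_top
        (isCompact_closedBall (0 : Space d) (R + 1)).measure_lt_top.ne
    · refine Eventually.of_forall fun x => ?_
      rw [← enorm_zero (E := ℂ)]
      refine (continuous_enorm.tendsto _).comp ?_
      by_cases hx : x ∈ K
      · simp only [Pi.sub_apply, Set.indicator_of_mem hx]
        simpa using (hlim x).sub_const (b₀ x)
      · simp [Set.indicator_of_notMem hx]
  set τ : ℕ → C(Space d, Space d) := fun i => ⟨fun x => x + a i, by fun_prop⟩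
  have hτ : Tendsto τ atTop (𝓝 (ContinuousMap.id (Space d))) := by
    rw [ContinuousMap.tendsto_iff_forall_isCompact_tendstoUniformlyOn]
    intro K' _
    rw [Metric.tendstoUniformlyOn_iff]
    intro δ hδ
    filter_upwards [Metric.tendsto_nhds.1 ha δ hδ] with i hi x _
    simpa [τ, dist_eq_norm] using hi
  have hτm : ∀ i, MeasurePreserving (τ i) volume volume := fun i =>
    measurePreserving_add_right volume (a i)
  have h := hL1.compMeasurePreservingLp hτ hτm (MeasurePreserving.id volume) ENNReal.one_ne_top
  rw [Lp.tendsto_Lp_iff_tendsto_eLpNorm'] at h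
  simp only [eLpNorm_one_eq_lintegral_enorm] at h
  refine tendsto_of_tendsto_of_tendsto_of_le_of_le' tendsto_const_nhds h
    (Eventually.of_forall fun _ => zero_le) ?_
  filter_upwards [Metric.tendsto_nhds.1 ha 1 zero_lt_one] with i hi
  rw [dist_zero_right] at hi
  refine le_trans (lintegral_mono_ae ?_) (setLIntegral_le_lintegral (Metric.closedBall 0 R) _)
  have h1 := Lp.coeFn_compMeasurePreserving (hmem (b i) (hb i) (hbC i)).toLp (hτm i)
  have h2 := (hτm i).quasiMeasurePreserving.ae_eq (hmem (b i) (hb i) (hbC i)).coeFn_toLp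
  have h3 := Lp.coeFn_compMeasurePreserving (hmem b₀ hb₀ hbC₀).toLp
    (MeasurePreserving.id (volume : Measure (Space d)))
  have h4 := (hmem b₀ hb₀ hbC₀).coeFn_toLp
  filter_upwards [ae_restrict_of_ae h1, ae_restrict_of_ae h2, ae_restrict_of_ae h3,
    ae_restrict_of_ae h4, ae_restrict_mem Metric.isClosed_closedBall.measurableSet]
    with x h1 h2 h3 h4 hx
  rw [mem_closedBall_zero_iff] at hx
  have m1 : x + a i ∈ K := by
    rw [mem_closedBall_zero_iff]
    exact (norm_add_le _ _).trans (by linarith)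
  have m2 : x ∈ K := by
    rw [mem_closedBall_zero_iff]
    linarith
  rw [Pi.sub_apply]
  have h5 : (Lp.compMeasurePreserving (τ i) (hτm i) (hmem (b i) (hb i) (hbC i)).toLp) x =
      b i (x + a i) := by
    refine h1.trans (h2.trans ?_)
    exact Set.indicator_of_mem m1 _
  have h6 : (Lp.compMeasurePreserving (ContinuousMap.id (Space d))
      (MeasurePreserving.id (volume : Measure (Space d))) (hmem b₀ hb₀ hbC₀).toLp) x = b₀ x := by
    refine h3.trans (h4.trans ?_)
    exact Set.indicator_of_mem m2 _
  exact le_of_eq (congrArg enorm (congrArg₂ (· - ·) h5.symm h6.symm))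

end Macroscopic

/-! ### Convergence of the two-point functions -/

section TwoPoint

variable {d : ℕ} {σ : Statistics}

/-- The `ℓ¹` error integrated over the ball tends to zero, by dominated convergence in `n`. A
subsequence with summable integrated errors then converges at almost every point. -/
theorem exists_subseq_ae_tendsto_tsum {b : ℕ → LatticePoint d → Space d → ℂ}
    {b₀ : LatticePoint d → Space d → ℂ} {g : LatticePoint d → ℝ} (hg : Summable g)
    (hb : ∀ i n, Measurable (b i n)) (hbg : ∀ i n x, ‖b i n x‖ ≤ g n)
    (hlim : ∀ n x, Tendsto (fun i => b i n x) atTop (𝓝 (b₀ n x)))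
    {a : ℕ → LatticePoint d → Space d} (ha : ∀ n, Tendsto (fun i => a i n) atTop (𝓝 0)) (R : ℝ) :
    ∃ ms : ℕ → ℕ, StrictMono ms ∧ ∀ᵐ x ∂volume.restrict (Metric.closedBall (0 : Space d) R),
      Tendsto (fun i => ∑' n, ‖b (ms i) n (x + a (ms i) n) - b₀ n x‖ₑ) atTop (𝓝 0) := by
  set μ := volume.restrict (Metric.closedBall (0 : Space d) R) with hμ
  have hfin : IsFiniteMeasure μ :=
    ⟨by simpa [hμ] using (isCompact_closedBall (0 : Space d) R).measure_lt_top⟩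
  have hb₀ : ∀ n, Measurable (b₀ n) := fun n =>
    measurable_of_tendsto_metrizable (fun i => hb i n) (tendsto_pi_nhds.2 (hlim n))
  have hbg₀ : ∀ n x, ‖b₀ n x‖ ≤ g n := fun n x =>
    le_of_tendsto (hlim n x).norm (Eventually.of_forall fun i => hbg i n x)
  have hm : ∀ i n, Measurable fun x => ‖b i n (x + a i n) - b₀ n x‖ₑ := fun i n =>
    (((hb i n).comp (measurable_add_const _)).sub (hb₀ n)).enorm
  have hg0 : ∀ n, 0 ≤ g n := fun n => (norm_nonneg _).trans (hbg₀ n 0)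
  have hint : Tendsto (fun i => ∫⁻ x, ∑' n, ‖b i n (x + a i n) - b₀ n x‖ₑ ∂μ) atTop (𝓝 0) := by
    -- The sum over `n` is read as an integral against counting measure, dominated by `2 g n` times
    -- the volume of the ball.
    have h := tendsto_lintegral_filter_of_dominated_convergence
      (μ := (Measure.count : Measure (LatticePoint d))) (l := atTop)
      (F := fun i n => ∫⁻ x, ‖b i n (x + a i n) - b₀ n x‖ₑ ∂μ) (f := fun _ => 0)
      (fun n => ENNReal.ofReal (2 * g n) * μ Set.univ) ?_ ?_ ?_ ?_
    · simp only [lintegral_count, tsum_zero] at h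
      refine h.congr fun i => ?_
      rw [lintegral_tsum fun n => (hm i n).aemeasurable]
    · exact Eventually.of_forall fun i => Measurable.of_discrete
    · refine Eventually.of_forall fun i => Eventually.of_forall fun n => ?_
      rw [← lintegral_const]
      refine lintegral_mono fun x => ?_
      rw [← ofReal_norm]
      refine ENNReal.ofReal_le_ofReal ((norm_sub_le _ _).trans ?_)
      linarith [hbg i n (x + a i n), hbg₀ n x]
    · rw [lintegral_count, ENNReal.tsum_mul_right]
      refine ENNReal.mul_ne_top ?_ (measure_ne_top μ _)
      rw [← ENNReal.ofReal_tsum_of_nonneg (fun n => by linarith [hg0 n]) (hg.mul_left 2)]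
      exact ENNReal.ofReal_ne_top
    · exact Eventually.of_forall fun n =>
        tendsto_lintegral_shift (fun i => hb i n) (fun i => hbg i n) (hlim n) (ha n) R
  -- Errors below `2⁻ⁱ` have a finite sum, so the sum of the pointwise errors is finite almost
  -- everywhere.
  obtain ⟨ms, hms, hle⟩ := extraction_forall_of_eventually'
    (P := fun i j => ∫⁻ x, ∑' n, ‖b j n (x + a j n) - b₀ n x‖ₑ ∂μ ≤ (2⁻¹ : ENNReal) ^ i) fun i =>
      (hint.eventually_le_const (by
        have : (0 : ENNReal) < 2⁻¹ ^ i := ENNReal.pow_pos (by simp) i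
        exact this)).exists_forall_of_atTop
  refine ⟨ms, hms, ?_⟩
  have hsum : ∫⁻ x, ∑' i, ∑' n, ‖b (ms i) n (x + a (ms i) n) - b₀ n x‖ₑ ∂μ ≠ ⊤ := by
    rw [lintegral_tsum fun i => (Measurable.tsum fun n => hm (ms i) n).aemeasurable]
    refine ne_top_of_le_ne_top ?_ (ENNReal.tsum_le_tsum hle)
    rw [ENNReal.tsum_geometric, ENNReal.one_sub_inv_two, inv_inv]
    exact ENNReal.ofNat_ne_top
  filter_upwards [ae_lt_top (Measurable.tsum fun i =>
    Measurable.tsum fun n => hm (ms i) n) hsum] with x hx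
  exact ENNReal.tendsto_atTop_zero_of_tsum_ne_top hx.ne

/-- The triangle inequality for `u = ∑ u(n) δ_n`; it lets summable coefficient bounds control `ℓ²`
norms. -/
theorem enorm_le_tsum_enorm (u : OneParticle d) : ‖u‖ₑ ≤ ∑' n, ‖u n‖ₑ := by
  have h := lp.hasSum_single (p := 2) ENNReal.ofNat_ne_top u
  refine (congrArg enorm h.tsum_eq).symm.le.trans
    (enorm_tsum_le_tsum_enorm.trans (ENNReal.tsum_le_tsum fun n => ?_))
  rw [← ofReal_norm, lp.norm_single (by norm_num), ofReal_norm]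

theorem norm_le_tsum_of_le (u : OneParticle d) {g : LatticePoint d → ℝ} (hg : Summable g)
    (h : ∀ n, ‖u n‖ ≤ g n) : ‖u‖ ≤ ∑' n, g n := by
  have hg0 : ∀ n, 0 ≤ g n := fun n => (norm_nonneg _).trans (h n)
  have h1 : ‖u‖ₑ ≤ ENNReal.ofReal (∑' n, g n) := by
    rw [ENNReal.ofReal_tsum_of_nonneg hg0 hg]
    refine (enorm_le_tsum_enorm u).trans (ENNReal.tsum_le_tsum fun n => ?_)
    rw [← ofReal_norm]
    exact ENNReal.ofReal_le_ofReal (h n)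
  rw [← ofReal_norm] at h1
  exact (ENNReal.ofReal_le_ofReal_iff (tsum_nonneg hg0)).1 h1

/-- The two-point function at separation `η` around the macroscopic point `x`. -/
def correlation (ω : FieldAlgebra σ (OneParticle d) →ₗ[ℂ] ℂ)
    (H : selfAdjoint (OneParticle d →L[ℂ] OneParticle d)) (ε t : ℝ) (η : LatticePoint d)
    (x : Space d) : ℂ :=
  twoPoint ω H (t / ε) (intPart (ε⁻¹ • x + (2⁻¹ : ℝ) • toSpace η))
    (intPart (ε⁻¹ • x - (2⁻¹ : ℝ) • toSpace η))

variable {ω : FieldAlgebra σ (OneParticle d) →ₗ[ℂ] ℂ}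
  {H : selfAdjoint (OneParticle d →L[ℂ] OneParticle d)} {ε t : ℝ}

theorem half_smul_add_half_smul (x : Space d) : (2⁻¹ : ℝ) • x + (2⁻¹ : ℝ) • x = x := by
  rw [← add_smul]
  norm_num

/-- The two points differ by the lattice vector `η`, and the integral part commutes with lattice
translations. Rounding therefore leaves the separation exactly `η`, so the clustering bound applies.
-/
theorem correlation_eq (η : LatticePoint d) (x : Space d) :
    correlation ω H ε t η x = twoPoint ω H (t / ε)
      (intPart (ε⁻¹ • x - (2⁻¹ : ℝ) • toSpace η) + η)
      (intPart (ε⁻¹ • x - (2⁻¹ : ℝ) • toSpace η)) := by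
  rw [correlation, ← intPart_add_toSpace]
  congr 2
  module

/-- Shifting the macroscopic point by `εη/2` moves the base point from the midpoint of the pair to
one of its ends. The shift vanishes as `ε → 0` for each fixed `η`. -/
theorem correlation_shift (hε : 0 < ε) (η : LatticePoint d) (x : Space d) :
    correlation ω H ε t η (x + (ε / 2) • toSpace η) = twoPoint ω H (t / ε)
      (intPart (ε⁻¹ • x) + η) (intPart (ε⁻¹ • x)) := by
  have e : ε⁻¹ • (x + (ε / 2) • toSpace η) - (2⁻¹ : ℝ) • toSpace η = ε⁻¹ • x := by
    rw [smul_add, smul_smul, show ε⁻¹ * (ε / 2) = 2⁻¹ by field_simp, add_sub_cancel_right]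
  rw [correlation_eq, e]

/-- The same shift with `-η` in place of `η` makes the base point the creation site, the order
occurring in `seenFrom_eq_twoPoint`. -/
theorem correlation_neg_shift (hε : 0 < ε) (η : LatticePoint d) (x : Space d) :
    correlation ω H ε t (-η) (x + (ε / 2) • toSpace η) = twoPoint ω H (t / ε)
      (intPart (ε⁻¹ • x)) (intPart (ε⁻¹ • x) + η) := by
  have e0 : toSpace (-η) = -toSpace η := by
    ext j
    simp [toSpace]
  have e : ε⁻¹ • (x + (ε / 2) • toSpace η) - (2⁻¹ : ℝ) • toSpace (-η) =
      ε⁻¹ • x + toSpace η := by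
    rw [e0, smul_add, smul_smul, show ε⁻¹ * (ε / 2) = 2⁻¹ by field_simp, smul_neg, sub_neg_eq_add,
      add_assoc, half_smul_add_half_smul]
  rw [correlation_eq, e, intPart_add_toSpace, add_neg_cancel_right]

theorem measurable_comp_intPart (q : LatticePoint d → LatticePoint d → ℂ) {A B : Space d → Space d}
    (hA : Measurable A) (hB : Measurable B) :
    Measurable fun x => q (intPart (A x)) (intPart (B x)) := by
  have h : Measurable fun p : LatticePoint d × LatticePoint d => q p.1 p.2 := Measurable.of_discrete
  exact h.comp ((measurable_intPart.comp hA).prodMk (measurable_intPart.comp hB))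

theorem measurable_correlation (η : LatticePoint d) : Measurable (correlation ω H ε t η) := by
  unfold correlation
  exact measurable_comp_intPart (twoPoint ω H (t / ε)) (by fun_prop) (by fun_prop)

theorem norm_correlation_le {g : LatticePoint d → ℝ}
    (hg : ∀ x η, ‖twoPoint ω H (t / ε) (x + η) x‖ ≤ g η) (η : LatticePoint d) (x : Space d) :
    ‖correlation ω H ε t η x‖ ≤ g η := by
  rw [correlation_eq]
  exact hg _ _

theorem norm_exp_I_mul (a : ℝ) : ‖Complex.exp (Complex.I * (a : ℂ))‖ = 1 := by
  rw [mul_comm, Complex.norm_exp_ofReal_mul_I]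

theorem hasSum_wigner {g : LatticePoint d → ℝ} (hgs : Summable g)
    (hg : ∀ x η, ‖twoPoint ω H (t / ε) (x + η) x‖ ≤ g η) (x k : Space d) :
    HasSum (fun η => Complex.exp (Complex.I * (phase k η : ℂ)) * correlation ω H ε t η x)
      ((((2 * Real.pi) ^ d : ℝ) : ℂ) * wigner ω H ε t x k) := by
  have hne : (((2 * Real.pi) ^ d : ℝ) : ℂ) ≠ 0 := by
    exact_mod_cast (by positivity : ((2 * Real.pi) ^ d : ℝ) ≠ 0)
  rw [wigner, mul_inv_cancel_left₀ hne]
  refine (Summable.of_norm_bounded hgs fun η => ?_).hasSum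
  rw [norm_mul, norm_exp_I_mul, one_mul]
  exact norm_correlation_le hg η x

theorem norm_wigner_le {g : LatticePoint d → ℝ} (hgs : Summable g)
    (hg : ∀ x η, ‖twoPoint ω H (t / ε) (x + η) x‖ ≤ g η) (x k : Space d) :
    ‖(((2 * Real.pi) ^ d : ℝ) : ℂ) * wigner ω H ε t x k‖ ≤ ∑' η, g η := by
  rw [← (hasSum_wigner hgs hg x k).tsum_eq]
  refine tsum_of_norm_bounded hgs.hasSum fun η => ?_
  rw [norm_mul, norm_exp_I_mul, one_mul]
  exact norm_correlation_le hg η x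

theorem measurable_wigner {g : LatticePoint d → ℝ} (hgs : Summable g)
    (hg : ∀ x η, ‖twoPoint ω H (t / ε) (x + η) x‖ ≤ g η) :
    Measurable fun p : Space d × Space d =>
      (((2 * Real.pi) ^ d : ℝ) : ℂ) * wigner ω H ε t p.1 p.2 := by
  have hlim : ∀ p : Space d × Space d, Tendsto (fun S : Finset (LatticePoint d) => ∑ η ∈ S,
      Complex.exp (Complex.I * (phase p.2 η : ℂ)) * correlation ω H ε t η p.1) atTop
      (𝓝 ((((2 * Real.pi) ^ d : ℝ) : ℂ) * wigner ω H ε t p.1 p.2)) := fun p => by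
    have h := hasSum_wigner hgs hg p.1 p.2
    rwa [HasSum, SummationFilter.unconditional_filter] at h
  refine measurable_of_tendsto_metrizable' atTop (fun S => ?_) (tendsto_pi_nhds.2 hlim)
  refine Finset.measurable_sum _ fun η _ => Measurable.mul ?_
    ((measurable_correlation η).comp measurable_fst)
  have hc : Continuous fun p : Space d × Space d => Complex.exp (Complex.I * (phase p.2 η : ℂ)) := by
    unfold phase
    fun_prop
  exact hc.measurable

/-- Inversion of an absolutely convergent Fourier series: integrating term by term against
`e^{-ik·η}` leaves the term `η` by orthogonality of characters. -/
theorem correlation_eq_integral {g : LatticePoint d → ℝ} (hgs : Summable g)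
    (hg : ∀ x η, ‖twoPoint ω H (t / ε) (x + η) x‖ ≤ g η) (η : LatticePoint d) (x : Space d) :
    correlation ω H ε t η x = ∫ k, Complex.exp (-(Complex.I * (phase k η : ℂ))) *
      ((((2 * Real.pi) ^ d : ℝ) : ℂ) * wigner ω H ε t x k) ∂brillouinMeasure d := by
  have e1 : ∀ (η' : LatticePoint d) (k : Space d), Complex.exp (-(Complex.I * (phase k η : ℂ))) *
      (Complex.exp (Complex.I * (phase k η' : ℂ)) * correlation ω H ε t η' x) =
      Complex.exp (Complex.I * (phase k (η' - η) : ℂ)) * correlation ω H ε t η' x :=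
    fun η' k => by
      rw [← mul_assoc, ← Complex.exp_add, phase_sub]
      congr 2
      push_cast
      ring
  have hcont : ∀ η' : LatticePoint d, Continuous fun k : Space d =>
      Complex.exp (Complex.I * (phase k (η' - η) : ℂ)) * correlation ω H ε t η' x := fun η' => by
    unfold phase
    fun_prop
  have hnorm : ∀ (η' : LatticePoint d) (k : Space d),
      ‖Complex.exp (Complex.I * (phase k (η' - η) : ℂ)) * correlation ω H ε t η' x‖ ≤ g η' :=
    fun η' k => by
      rw [norm_mul, norm_exp_I_mul, one_mul]
      exact norm_correlation_le hg η' x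
  have hint : ∀ η', Integrable (fun k : Space d =>
      Complex.exp (Complex.I * (phase k (η' - η) : ℂ)) * correlation ω H ε t η' x)
      (brillouinMeasure d) := fun η' =>
    Integrable.of_bound (hcont η').aestronglyMeasurable (g η') (Eventually.of_forall (hnorm η'))
  have h := hasSum_integral_of_summable_integral_norm hint (by
    refine Summable.of_nonneg_of_le (fun η' => integral_nonneg fun k => norm_nonneg _) (fun η' => ?_)
      (hgs.mul_right ((brillouinMeasure d).real Set.univ))
    refine (integral_mono (hint η').norm (integrable_const (g η')) (hnorm η')).trans_eq ?_
    rw [integral_const, smul_eq_mul, mul_comm])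
  have e2 : ∀ k : Space d, ∑' η', Complex.exp (Complex.I * (phase k (η' - η) : ℂ)) *
      correlation ω H ε t η' x = Complex.exp (-(Complex.I * (phase k η : ℂ))) *
      ((((2 * Real.pi) ^ d : ℝ) : ℂ) * wigner ω H ε t x k) := fun k => by
    rw [← (hasSum_wigner hgs hg x k).tsum_eq, ← tsum_mul_left]
    exact tsum_congr fun η' => (e1 η' k).symm
  simp only [e2, integral_mul_const, integral_exp_phase, sub_eq_zero, ite_mul, one_mul,
    zero_mul] at h
  exact (hasSum_ite_eq η _ |>.congr_fun fun η' => by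
    split_ifs with h0
    · rw [h0]
    · rfl).unique h

end TwoPoint

/-! ### The covariance of the fluctuation field -/

section Covariance

variable {d : ℕ} {σ : Statistics}

theorem exists_finset_of_hasCompactSupport {ψ : Space d → ℂ} (hψ : HasCompactSupport ψ) {ε : ℝ}
    (hε : 0 < ε) : ∃ S : Finset (LatticePoint d), ∀ x, ψ (ε • toSpace x) ≠ 0 → x ∈ S := by
  obtain ⟨R, hR⟩ := hψ.isCompact.isBounded.exists_norm_le
  refine ⟨Fintype.piFinset fun _ => Finset.Icc (-⌈R / ε⌉) ⌈R / ε⌉, fun x hx => ?_⟩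
  rw [Fintype.mem_piFinset]
  intro j
  have h1 := (PiLp.norm_apply_le _ j).trans (hR _ (subset_tsupport _ hx))
  have h2 : ε * |(x j : ℝ)| ≤ R := by
    have e : (ε • toSpace x) j = ε * (x j : ℝ) := rfl
    rwa [e, norm_mul, Real.norm_eq_abs, abs_of_pos hε, Real.norm_eq_abs] at h1
  have h3 : |(x j : ℝ)| ≤ (⌈R / ε⌉ : ℝ) := by
    refine le_trans ?_ (Int.le_ceil _)
    rw [le_div_iff₀ hε, mul_comm]
    exact h2
  rw [Finset.mem_Icc, ← abs_le]
  exact_mod_cast h3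

/-- The vector `U⁻¹ A U δ_y` seen from the lattice point `y`. -/
def seenFrom (U : OneParticle d ≃ₗᵢ[ℂ] OneParticle d) (A : OneParticle d →L[ℂ] OneParticle d)
    (y : LatticePoint d) : OneParticle d :=
  (translation y).symm (U.symm (A (U (site y))))

theorem translation_seenFrom (U : OneParticle d ≃ₗᵢ[ℂ] OneParticle d)
    (A : OneParticle d →L[ℂ] OneParticle d) (y : LatticePoint d) :
    translation y (seenFrom U A y) = U.symm (A (U (site y))) :=
  (translation y).apply_symm_apply _

theorem seenFrom_apply (U : OneParticle d ≃ₗᵢ[ℂ] OneParticle d)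
    (A : OneParticle d →L[ℂ] OneParticle d) (y n : LatticePoint d) :
    seenFrom U A y n = ⟪U (site (y + n)), A (U (site y))⟫_ℂ := by
  rw [seenFrom, translation_symm_apply, ← inner_site, ← U.inner_map_map, U.apply_symm_apply,
    add_comm]

theorem translation_site_zero (y : LatticePoint d) : translation y (site 0) = site y := by
  ext n
  rw [site_apply]
  change site 0 (n - y) = _
  rw [site_apply]
  simp only [sub_eq_zero]

section Microscopic

variable {ω : FieldAlgebra σ (OneParticle d) →ₗ[ℂ] ℂ}
  {H : selfAdjoint (OneParticle d →L[ℂ] OneParticle d)}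
  {T : OneParticle d →L[ℂ] OneParticle d} (hT : ∀ u v, ω (cre σ u * ann σ v) = ⟪v, T u⟫_ℂ)
include hT

theorem twoPoint_eq_inner (τ : ℝ) (x y : LatticePoint d) :
    twoPoint ω H τ x y = ⟪evolution H τ (site y), T (evolution H τ (site x))⟫_ℂ := by
  rw [twoPoint, timeEvolution_density, hT]

theorem seenFrom_eq_twoPoint (τ : ℝ) (y n : LatticePoint d) :
    seenFrom (evolution H τ) T y n = twoPoint ω H τ y (y + n) := by
  rw [seenFrom_apply, twoPoint_eq_inner hT]

/-- The adjoint appears because `ω(a*(u)a(v)) = ⟨T* v, u⟩` is used with `v` at the base point.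
Self-adjointness of `T` is not presupposed, so both orders of the sites are followed separately. -/
theorem seenFrom_adjoint_eq_twoPoint (τ : ℝ) (y n : LatticePoint d) :
    seenFrom (evolution H τ) (ContinuousLinearMap.adjoint T) y n =
      starRingEnd ℂ (twoPoint ω H τ (y + n) y) := by
  rw [seenFrom_apply, twoPoint_eq_inner hT, ContinuousLinearMap.adjoint_inner_right,
    inner_conj_symm]

/-- Since `U_t = U_s U_{t-s}`, the sum of `F(εx) |U_t δ_x⟩⟨U_t δ_x|` over `x` is `U_s F(r^ε(t-s))
U_s⁻¹`. Unitarity of `U_s` and of the translation by `y` moves everything to the reference site `0`,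
where the limits of operator and vectors can be taken. -/
theorem covariance_eq_integral (hω : IsQuasiFreeState σ ω) {ε : ℝ} (hε : 0 < ε)
    (F : Space d →ᵇ ℂ) (hF : HasCompactSupport F) {φ : Space d → ℂ} (hφ : HasCompactSupport φ)
    (t s : ℝ) :
    ω (fluctuation ω H ε F t * fluctuation ω H ε φ s) =
      ∫ x : Space d, φ (ε • toSpace (intPart (ε⁻¹ • x))) *
        ⟪seenFrom (evolution H (s / ε)) (ContinuousLinearMap.adjoint T) (intPart (ε⁻¹ • x)),
          heisenberg H ε (t - s) (intPart (ε⁻¹ • x)) F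
            (site 0 + σ.sign • seenFrom (evolution H (s / ε)) T (intPart (ε⁻¹ • x)))⟫_ℂ := by
  classical
  obtain ⟨S₁, hS₁⟩ := exists_finset_of_hasCompactSupport hF hε
  obtain ⟨S₂, hS₂⟩ := exists_finset_of_hasCompactSupport hφ hε
  have h₁ : ∀ x, F (ε • toSpace x) ≠ 0 → x ∈ S₁ ∪ S₂ := fun x hx =>
    Finset.mem_union_left _ (hS₁ x hx)
  have h₂ : ∀ x, φ (ε • toSpace x) ≠ 0 → x ∈ S₁ ∪ S₂ := fun x hx =>
    Finset.mem_union_right _ (hS₂ x hx)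
  rw [covariance_eq_sum hω H hε F φ t s (S₁ ∪ S₂) h₁ h₂,
    integral_comp_intPart hε (fun y => φ (ε • toSpace y) *
      ⟪seenFrom (evolution H (s / ε)) (ContinuousLinearMap.adjoint T) y,
        heisenberg H ε (t - s) y F
          (site 0 + σ.sign • seenFrom (evolution H (s / ε)) T y)⟫_ℂ) (S₁ ∪ S₂)
      fun y hy => h₂ y (left_ne_zero_of_mul hy)]
  congr 1
  refine Finset.sum_congr rfl fun y _ => ?_
  congr 1
  have hU : ∀ x, evolution H (s / ε) (evolution H ((t - s) / ε) (site x)) =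
      evolution H (t / ε) (site x) := fun x => by
    rw [← evolution_add]
    congr 2
    ring
  rw [heisenberg_apply, ← (translation y).inner_map_map, LinearIsometryEquiv.apply_symm_apply,
    map_add, map_smul, translation_seenFrom, translation_seenFrom, translation_site_zero,
    ← (evolution H ((t - s) / ε)).symm.inner_map_map, LinearIsometryEquiv.symm_apply_apply,
    diagonal_eq_sum ε F _ h₁]
  refine Finset.sum_congr rfl fun x _ => ?_
  congr 1
  -- The vector to the left of the operator yields the first Wick factor; `e2` recovers the
  -- contraction and the second Wick factor from the right vector.
  have e1 : ⟪(evolution H ((t - s) / ε)).symm ((evolution H (s / ε)).symm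
      (ContinuousLinearMap.adjoint T (evolution H (s / ε) (site y)))), site x⟫_ℂ =
      ω (cre σ (evolution H (t / ε) (site x)) * ann σ (evolution H (s / ε) (site y))) := by
    rw [← (evolution H ((t - s) / ε)).inner_map_map, LinearIsometryEquiv.apply_symm_apply,
      ← (evolution H (s / ε)).inner_map_map, LinearIsometryEquiv.apply_symm_apply, hU, hT,
      ContinuousLinearMap.adjoint_inner_left]
  have e2 : ⟪site x, (evolution H ((t - s) / ε)).symm
      (site y + σ.sign • (evolution H (s / ε)).symm (T (evolution H (s / ε) (site y))))⟫_ℂ =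
      ⟪evolution H (t / ε) (site x), evolution H (s / ε) (site y)⟫_ℂ + σ.sign *
        ω (cre σ (evolution H (s / ε) (site y)) * ann σ (evolution H (t / ε) (site x))) := by
    rw [← (evolution H ((t - s) / ε)).inner_map_map, LinearIsometryEquiv.apply_symm_apply,
      ← (evolution H (s / ε)).inner_map_map, hU, map_add, map_smul,
      LinearIsometryEquiv.apply_symm_apply, inner_add_right, inner_smul_right, hT]
  rw [e1, e2]

end Microscopic

/-- In the wave vector representation `δ_0` is the constant function `1`, and `F` is real, so
Parseval's identity gives the product `F (1 + cF)` weighted by `P`. -/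
theorem inner_repr_multiplier_site_add (P : Space d →ᵇ ℂ) {F : Space d → ℝ}
    (hF : MemLp (fun k => (F k : ℂ)) 2 (brillouinMeasure d)) (c : ℂ) :
    ⟪(characterBasis d).repr hF.toLp,
      multiplier d P (site 0 + c • (characterBasis d).repr hF.toLp)⟫_ℂ =
      ∫ k, P k * F k * (1 + c * F k) ∂brillouinMeasure d := by
  have e0 : site (0 : LatticePoint d) = (characterBasis d).repr (characterLp 0) := by
    rw [← characterBasis_apply, HilbertBasis.repr_self]
    rfl
  rw [e0, ← map_smul, ← map_add, inner_multiplier]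
  refine integral_congr_ae ?_
  filter_upwards [hF.coeFn_toLp, coeFn_characterLp (0 : LatticePoint d),
    Lp.coeFn_add (characterLp 0) (c • hF.toLp), Lp.coeFn_smul c hF.toLp] with k h1 h2 h3 h4
  rw [h3, Pi.add_apply, h2, h4, Pi.smul_apply, h1, Complex.conj_ofReal, character_apply]
  simp [phase]
  ring

section Limit

variable {ω : ℕ → FieldAlgebra σ (OneParticle d) →ₗ[ℂ] ℂ}
  {H : ℕ → selfAdjoint (OneParticle d →L[ℂ] OneParticle d)} {e : ℕ → ℝ} {s : ℝ}
  {g : LatticePoint d → ℝ} {f : Space d → Space d → ℝ}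

theorem norm_le_of_tendsto_wigner (hgs : Summable g)
    (hg : ∀ i x η, ‖twoPoint (ω i) (H i) (s / e i) (x + η) x‖ ≤ g η)
    (hf : ∀ x, ∀ k ∈ brillouin d,
      Tendsto (fun i => wigner (ω i) (H i) (e i) s x k) atTop (𝓝 (f x k : ℂ)))
    (x : Space d) {k : Space d} (hk : k ∈ brillouin d) :
    ‖(((2 * Real.pi) ^ d * f x k : ℝ) : ℂ)‖ ≤ ∑' η, g η := by
  rw [Complex.ofReal_mul]
  exact le_of_tendsto ((hf x k hk).const_mul _).norm
    (Eventually.of_forall fun i => norm_wigner_le hgs (hg i) x k)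

theorem memLp_of_tendsto_wigner (hgs : Summable g)
    (hg : ∀ i x η, ‖twoPoint (ω i) (H i) (s / e i) (x + η) x‖ ≤ g η)
    (hf : ∀ x, ∀ k ∈ brillouin d,
      Tendsto (fun i => wigner (ω i) (H i) (e i) s x k) atTop (𝓝 (f x k : ℂ))) (x : Space d) :
    MemLp (fun k => (((2 * Real.pi) ^ d * f x k : ℝ) : ℂ)) 2 (brillouinMeasure d) := by
  refine MemLp.of_bound (C := ∑' η, g η) ?_ ?_
  · refine aestronglyMeasurable_of_tendsto_ae atTop
      (f := fun i k => (((2 * Real.pi) ^ d : ℝ) : ℂ) * wigner (ω i) (H i) (e i) s x k)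
      (fun i => ((measurable_wigner hgs (hg i)).comp
        measurable_prodMk_left).aestronglyMeasurable) ?_
    filter_upwards [ae_mem_brillouin] with k hk
    rw [Complex.ofReal_mul]
    exact (hf x k hk).const_mul _
  · filter_upwards [ae_mem_brillouin] with k hk
    exact norm_le_of_tendsto_wigner hgs hg hf x hk

/-- Dominated convergence in the inversion formula `correlation_eq_integral`, with the constant `∑
g` as majorant on the finite measure of the zone. -/
theorem tendsto_correlation (hgs : Summable g)
    (hg : ∀ i x η, ‖twoPoint (ω i) (H i) (s / e i) (x + η) x‖ ≤ g η)
    (hf : ∀ x, ∀ k ∈ brillouin d,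
      Tendsto (fun i => wigner (ω i) (H i) (e i) s x k) atTop (𝓝 (f x k : ℂ)))
    (η : LatticePoint d) (x : Space d) :
    Tendsto (fun i => correlation (ω i) (H i) (e i) s η x) atTop
      (𝓝 (∫ k, Complex.exp (-(Complex.I * (phase k η : ℂ))) *
        (((2 * Real.pi) ^ d * f x k : ℝ) : ℂ) ∂brillouinMeasure d)) := by
  have e1 : ∀ i, correlation (ω i) (H i) (e i) s η x = _ := fun i =>
    correlation_eq_integral hgs (hg i) η x
  simp only [e1]
  have hc : Continuous fun k : Space d => Complex.exp (-(Complex.I * (phase k η : ℂ))) := by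
    unfold phase
    fun_prop
  refine tendsto_integral_filter_of_dominated_convergence (fun _ => ∑' η, g η)
    (Eventually.of_forall fun i => ?_) (Eventually.of_forall fun i =>
      Eventually.of_forall fun k => ?_) (integrable_const _) ?_
  · exact (hc.measurable.mul ((measurable_wigner hgs (hg i)).comp
      measurable_prodMk_left)).aestronglyMeasurable
  · rw [norm_mul, ← mul_neg, ← Complex.ofReal_neg, norm_exp_I_mul, one_mul]
    exact norm_wigner_le hgs (hg i) x k
  · filter_upwards [ae_mem_brillouin] with k hk
    rw [Complex.ofReal_mul]
    exact ((hf x k hk).const_mul _).const_mul _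

end Limit

end Covariance

/-! ### Passage to the limit in the covariance -/

section Covariance

variable {d : ℕ} {σ : Statistics}

theorem tendsto_smul_intPart {e : ℕ → ℝ} (he : ∀ i, 0 < e i) (he0 : Tendsto e atTop (𝓝 0))
    (x : Space d) : Tendsto (fun i => e i • toSpace (intPart ((e i)⁻¹ • x))) atTop (𝓝 x) := by
  rw [tendsto_iff_norm_sub_tendsto_zero]
  refine squeeze_zero (fun i => norm_nonneg _) (fun i => norm_smul_intPart_sub_le (he i) x) ?_
  simpa using he0.mul_const (d : ℝ)

/-- Convergence in `ℓ²` from convergence of the sums of coefficient errors. -/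
theorem tendsto_of_tsum_enorm_sub {v : ℕ → OneParticle d} {v₀ : OneParticle d}
    (h : Tendsto (fun i => ∑' n, ‖v i n - v₀ n‖ₑ) atTop (𝓝 0)) : Tendsto v atTop (𝓝 v₀) := by
  rw [tendsto_iff_edist_tendsto_0]
  refine tendsto_of_tendsto_of_tendsto_of_le_of_le tendsto_const_nhds h (fun _ => zero_le)
    fun i => ?_
  rw [edist_eq_enorm_sub]
  exact enorm_le_tsum_enorm (v i - v₀)

/-- At almost every `x` both vectors converge in `ℓ²` along a subsequence and the operators converge
strongly, so the matrix elements converge. They are bounded uniformly by clustering and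
contractivity, and dominated convergence on a ball finishes the argument. Two successive extractions
handle the left and the right vector. -/
theorem exists_subseq_tendsto_covariance
    {ω : ℕ → FieldAlgebra σ (OneParticle d) →ₗ[ℂ] ℂ}
    {H : ℕ → selfAdjoint (OneParticle d →L[ℂ] OneParticle d)} {e : ℕ → ℝ} {s : ℝ}
    {g : LatticePoint d → ℝ} {f : Space d → Space d → ℝ}
    (he : ∀ i, 0 < e i) (he0 : Tendsto e atTop (𝓝 0)) (hω : ∀ i, IsQuasiFreeState σ (ω i))
    (hgs : Summable g) (hg : ∀ i x η, ‖twoPoint (ω i) (H i) (s / e i) (x + η) x‖ ≤ g η)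
    (hf : ∀ x, ∀ k ∈ brillouin d,
      Tendsto (fun i => wigner (ω i) (H i) (e i) s x k) atTop (𝓝 (f x k : ℂ)))
    (t : ℝ) (F : Space d →ᵇ ℂ) (hF : HasCompactSupport F) (ρ : Space d → C(Space d, Space d))
    (hρ : ∀ x u, Tendsto (fun i => heisenberg (H i) (e i) (t - s) (intPart ((e i)⁻¹ • x)) F u) atTop
      (𝓝 (multiplier d (pullback (ρ x) F) u)))
    {φ : Space d → ℂ} (hφ : Continuous φ) (hφc : HasCompactSupport φ) :
    ∃ ms : ℕ → ℕ, Tendsto (fun i => ω (ms i)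
      (fluctuation (ω (ms i)) (H (ms i)) (e (ms i)) F t *
        fluctuation (ω (ms i)) (H (ms i)) (e (ms i)) φ s)) atTop
      (𝓝 (∫ x, φ x * ∫ k, F (ρ x k) * (((2 * Real.pi) ^ d * f x k : ℝ) : ℂ) *
        (1 + σ.sign * (((2 * Real.pi) ^ d * f x k : ℝ) : ℂ)) ∂brillouinMeasure d)) := by
  choose T hT using fun i => (hω i).exists_operator
  have hgneg : Summable fun n => g (-n) := (Equiv.neg (LatticePoint d)).summable_iff.2 hgs
  have hg0 : ∀ n, 0 ≤ g n := fun n => (norm_nonneg _).trans (hg 0 0 n)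
  set C : ℝ := ∑' n, g n with hC
  have hC0 : 0 ≤ C := tsum_nonneg hg0
  have hCneg : ∑' n, g (-n) = C := (Equiv.neg (LatticePoint d)).tsum_eq g
  have hmem := memLp_of_tendsto_wigner hgs hg hf
  set V : Space d → OneParticle d := fun x => (characterBasis d).repr (hmem x).toLp
  have hV : ∀ x n, V x n = ∫ k, Complex.exp (Complex.I * (phase k n : ℂ)) *
      (((2 * Real.pi) ^ d * f x k : ℝ) : ℂ) ∂brillouinMeasure d := fun x n => by
    refine (characterBasis_repr _ n).trans (integral_congr_ae ?_)
    filter_upwards [(hmem x).coeFn_toLp] with k hk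
    rw [hk]
  have hVneg : ∀ x n, V x n = ∫ k, Complex.exp (-(Complex.I * (phase k (-n) : ℂ))) *
      (((2 * Real.pi) ^ d * f x k : ℝ) : ℂ) ∂brillouinMeasure d := fun x n => by
    rw [hV]
    simp [phase_neg]
  -- Reality of `f` makes the limits of the left and right vectors the same `V x`.
  have hVconj : ∀ x n, V x n = starRingEnd ℂ (∫ k, Complex.exp (-(Complex.I * (phase k n : ℂ))) *
      (((2 * Real.pi) ^ d * f x k : ℝ) : ℂ) ∂brillouinMeasure d) := fun x n => by
    rw [hV, ← integral_conj]
    refine integral_congr_ae (Eventually.of_forall fun k => ?_)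
    simp only [map_mul, Complex.conj_ofReal, ← Complex.exp_conj, map_neg, Complex.conj_I, neg_mul,
      neg_neg]
  have hcorr := tendsto_correlation hgs hg hf
  have hshift : ∀ {e' : ℕ → ℝ}, Tendsto e' atTop (𝓝 0) → ∀ n : LatticePoint d,
      Tendsto (fun i => (e' i / 2) • toSpace n) atTop (𝓝 0) := fun h n => by
    simpa using (h.div_const 2).smul_const (toSpace n)
  obtain ⟨R, hR⟩ := hφc.isCompact.isBounded.exists_norm_le
  have hφR : ∀ x, R < ‖x‖ → φ x = 0 := fun x hx => by
    by_contra h0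
    exact absurd (hR x (subset_tsupport _ h0)) (not_le.2 hx)
  -- The radius `R + d` allows for the rounding of `x` to the lattice, which moves it by at most
  -- `εd`.
  obtain ⟨m₁, hm₁, hae₁⟩ := exists_subseq_ae_tendsto_tsum hgs
    (b := fun i n => correlation (ω i) (H i) (e i) s n) (fun i n => measurable_correlation n)
    (fun i n x => norm_correlation_le (hg i) n x) hcorr (hshift he0) (R + d)
  have he1 : Tendsto (fun i => e (m₁ i)) atTop (𝓝 0) := he0.comp hm₁.tendsto_atTop
  obtain ⟨m₂, hm₂, hae₂⟩ := exists_subseq_ae_tendsto_tsum hgneg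
    (b := fun i n => correlation (ω (m₁ i)) (H (m₁ i)) (e (m₁ i)) s (-n))
    (fun i n => measurable_correlation (-n))
    (fun i n x => norm_correlation_le (hg (m₁ i)) (-n) x)
    (fun n x => (hcorr (-n) x).comp hm₁.tendsto_atTop) (hshift he1) (R + d)
  have he2 : Tendsto (fun i => e (m₁ (m₂ i))) atTop (𝓝 0) := he1.comp hm₂.tendsto_atTop
  -- Keeping `ε ≤ 1` bounds the rounding error by `d`, so `φ` at the rounded point vanishes whenever
  -- `x` lies outside the ball of radius `R + d`.
  obtain ⟨N, hN⟩ := eventually_atTop.1 (he2.eventually_le_const zero_lt_one)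
  set m : ℕ → ℕ := fun i => m₁ (m₂ (i + N))
  have hm : Tendsto m atTop atTop :=
    hm₁.tendsto_atTop.comp (hm₂.tendsto_atTop.comp (tendsto_add_atTop_nat N))
  have hem : Tendsto (fun i => e (m i)) atTop (𝓝 0) := he0.comp hm
  have hem1 : ∀ i, e (m i) ≤ 1 := fun i => hN _ (Nat.le_add_left N i)
  refine ⟨m, ?_⟩
  set K : Set (Space d) := Metric.closedBall 0 (R + d)
  set y : ℕ → Space d → LatticePoint d := fun i x => intPart ((e (m i))⁻¹ • x)
  set v : ℕ → LatticePoint d → OneParticle d := fun i =>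
    seenFrom (evolution (H (m i)) (s / e (m i))) (ContinuousLinearMap.adjoint (T (m i)))
  set u : ℕ → LatticePoint d → OneParticle d := fun i =>
    seenFrom (evolution (H (m i)) (s / e (m i))) (T (m i))
  set Q : ℕ → LatticePoint d → ℂ := fun i a =>
    ⟪v i a, heisenberg (H (m i)) (e (m i)) (t - s) a F (site 0 + σ.sign • u i a)⟫_ℂ
  have hcov : ∀ i, ω (m i) (fluctuation (ω (m i)) (H (m i)) (e (m i)) F t *
      fluctuation (ω (m i)) (H (m i)) (e (m i)) φ s) =
      ∫ x in K, φ (e (m i) • toSpace (y i x)) * Q i (y i x) := fun i => by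
    rw [covariance_eq_integral (hT (m i)) (hω (m i)) (he (m i)) F hF hφc t s]
    refine (setIntegral_eq_integral_of_forall_compl_eq_zero fun x hx => ?_).symm
    rw [hφR, zero_mul]
    have h1 := norm_smul_intPart_sub_le (he (m i)) x
    have h2 : e (m i) * d ≤ d := mul_le_of_le_one_left (Nat.cast_nonneg d) (hem1 i)
    rw [mem_closedBall_zero_iff, not_le] at hx
    have h3 := norm_sub_norm_le x (e (m i) • toSpace (intPart ((e (m i))⁻¹ • x)))
    rw [norm_sub_rev] at h3
    linarith
  have hlimit : ∀ x, φ x * (∫ k, F (ρ x k) * (((2 * Real.pi) ^ d * f x k : ℝ) : ℂ) *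
      (1 + σ.sign * (((2 * Real.pi) ^ d * f x k : ℝ) : ℂ)) ∂brillouinMeasure d) =
      φ x * ⟪V x, multiplier d (pullback (ρ x) F) (site 0 + σ.sign • V x)⟫_ℂ := fun x => by
    rw [inner_repr_multiplier_site_add _ (hmem x)]
    rfl
  simp only [hcov, hlimit]
  rw [← setIntegral_eq_integral_of_forall_compl_eq_zero (s := K) fun x hx => by
    rw [hφR, zero_mul]
    rw [mem_closedBall_zero_iff, not_le] at hx
    linarith [(Nat.cast_nonneg d : (0 : ℝ) ≤ d)]]
  have hfin : IsFiniteMeasure (volume.restrict K) :=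
    ⟨by simpa using (isCompact_closedBall (0 : Space d) (R + d)).measure_lt_top⟩
  obtain ⟨Cφ, hCφ⟩ := hφc.exists_bound_of_continuous hφ
  have hsign : ‖σ.sign‖ = 1 := by cases σ <;> simp [Statistics.sign]
  have hvC : ∀ i a, ‖v i a‖ ≤ C := fun i a => norm_le_tsum_of_le _ hgs fun n => by
    rw [seenFrom_adjoint_eq_twoPoint (hT (m i)), RCLike.norm_conj]
    exact hg (m i) a n
  have huC : ∀ i a, ‖u i a‖ ≤ C := fun i a => by
    rw [← hCneg]
    refine norm_le_tsum_of_le _ hgneg fun n => ?_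
    rw [seenFrom_eq_twoPoint (hT (m i))]
    have h := hg (m i) (a + n) (-n)
    rwa [add_neg_cancel_right] at h
  have hQC : ∀ i a, ‖Q i a‖ ≤ C * (‖F‖ * (1 + C)) := fun i a => by
    refine (norm_inner_le_norm _ _).trans (mul_le_mul (hvC i a) ?_ (norm_nonneg _) hC0)
    refine ((heisenberg _ _ _ _ F).le_of_opNorm_le (norm_heisenberg_le _ _ _ _ F) _).trans ?_
    refine mul_le_mul_of_nonneg_left ((norm_add_le _ _).trans ?_) (norm_nonneg F)
    rw [norm_site, norm_smul, hsign, one_mul]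
    exact add_le_add_right (huC i a) 1
  refine tendsto_integral_filter_of_dominated_convergence
    (fun _ => Cφ * (C * (‖F‖ * (1 + C)))) (Eventually.of_forall fun i => ?_)
    (Eventually.of_forall fun i => Eventually.of_forall fun x => ?_) (integrable_const _) ?_
  · exact (measurable_comp_intPart (fun a _ => φ (e (m i) • toSpace a) * Q i a)
      (measurable_const_smul (e (m i))⁻¹) measurable_id).aestronglyMeasurable
  · rw [norm_mul]
    exact mul_le_mul (hCφ _) (hQC i _) (norm_nonneg _) ((norm_nonneg _).trans (hCφ 0))
  · filter_upwards [hae₁, hae₂] with x h₁ h₂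
    have hv : Tendsto (fun i => v i (y i x)) atTop (𝓝 (V x)) := by
      refine tendsto_of_tsum_enorm_sub ((h₁.comp
        (hm₂.tendsto_atTop.comp (tendsto_add_atTop_nat N))).congr fun i => tsum_congr fun n => ?_)
      rw [hVconj, seenFrom_adjoint_eq_twoPoint (hT (m i)), ← map_sub, ← correlation_shift (he (m i)),
        ← ofReal_norm, ← ofReal_norm, RCLike.norm_conj]
      rfl
    have hu : Tendsto (fun i => u i (y i x)) atTop (𝓝 (V x)) := by
      refine tendsto_of_tsum_enorm_sub ((h₂.comp
        (tendsto_add_atTop_nat N)).congr fun i => tsum_congr fun n => ?_)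
      rw [hVneg, seenFrom_eq_twoPoint (hT (m i)), ← correlation_neg_shift (he (m i))]
    have hw : Tendsto (fun i => site 0 + σ.sign • u i (y i x)) atTop
        (𝓝 (site 0 + σ.sign • V x)) := (hu.const_smul σ.sign).const_add _
    refine ((hφ.tendsto x).comp (tendsto_smul_intPart (fun i => he (m i)) hem x)).mul
      (hv.inner ?_)
    -- Strong convergence concerns fixed vectors; the varying part of the argument is absorbed by
    -- the uniform bound `‖F‖`.
    have h3 : Tendsto (fun i => heisenberg (H (m i)) (e (m i)) (t - s) (y i x) F
        ((site 0 + σ.sign • u i (y i x)) - (site 0 + σ.sign • V x))) atTop (𝓝 0) := by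
      have h4 := (hw.sub_const (site 0 + σ.sign • V x)).norm.const_mul ‖F‖
      rw [sub_self, norm_zero, mul_zero] at h4
      exact squeeze_zero_norm (fun i => (heisenberg _ _ _ _ F).le_of_opNorm_le
        (norm_heisenberg_le _ _ _ _ F) _) h4
    have h5 := h3.add ((hρ x (site 0 + σ.sign • V x)).comp hm)
    rw [zero_add] at h5
    refine h5.congr fun i => ?_
    rw [map_sub]
    exact sub_add_cancel _ _

theorem aestronglyMeasurable_of_tendsto_wigner
    {ω : ℕ → FieldAlgebra σ (OneParticle d) →ₗ[ℂ] ℂ}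
    {H : ℕ → selfAdjoint (OneParticle d →L[ℂ] OneParticle d)} {e : ℕ → ℝ} {s : ℝ}
    {g : LatticePoint d → ℝ} {f : Space d → Space d → ℝ}
    (hgs : Summable g) (hg : ∀ i x η, ‖twoPoint (ω i) (H i) (s / e i) (x + η) x‖ ≤ g η)
    (hf : ∀ x, ∀ k ∈ brillouin d,
      Tendsto (fun i => wigner (ω i) (H i) (e i) s x k) atTop (𝓝 (f x k : ℂ))) :
    AEStronglyMeasurable (fun p : Space d × Space d => (f p.1 p.2 : ℂ))
      (volume.restrict (Set.univ ×ˢ brillouin d)) := by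
  have hne : (((2 * Real.pi) ^ d : ℝ) : ℂ) ≠ 0 :=
    Complex.ofReal_ne_zero.2 (by positivity)
  have hw : ∀ i, Measurable fun p : Space d × Space d => wigner (ω i) (H i) (e i) s p.1 p.2 :=
    fun i => by
      have h := (measurable_wigner hgs (hg i)).const_mul (((2 * Real.pi) ^ d : ℝ) : ℂ)⁻¹
      simpa only [inv_mul_cancel_left₀ hne] using h
  refine aestronglyMeasurable_of_tendsto_ae atTop (fun i => (hw i).aestronglyMeasurable) ?_
  filter_upwards [ae_restrict_mem (MeasurableSet.univ.prod measurableSet_brillouin)] with p hp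
  exact hf p.1 p.2 hp.2

/-- The density vanishes unless `x` lies in the support of `φ`. On the resulting compact set it is
bounded, `(2π)^d |f|` being at most `∑ g`, and `f` is measurable there as a limit of distribution
functions. -/
theorem integrableOn_covarianceDensity
    {ω : ℕ → FieldAlgebra σ (OneParticle d) →ₗ[ℂ] ℂ}
    {H : ℕ → selfAdjoint (OneParticle d →L[ℂ] OneParticle d)} {e : ℕ → ℝ} {s : ℝ}
    {g : LatticePoint d → ℝ} {f : Space d → Space d → ℝ}
    (hgs : Summable g) (hg : ∀ i x η, ‖twoPoint (ω i) (H i) (s / e i) (x + η) x‖ ≤ g η)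
    (hf : ∀ x, ∀ k ∈ brillouin d,
      Tendsto (fun i => wigner (ω i) (H i) (e i) s x k) atTop (𝓝 (f x k : ℂ)))
    {r : ℝ → Space d → Space d → Space d} {τ : ℝ}
    (hr : Continuous fun p : Space d × Space d => r τ p.1 p.2) {ψ φ : Space d → ℂ}
    (hψ : ContDiff ℝ (⊤ : ℕ∞) ψ) (hψc : HasCompactSupport ψ)
    (hφ : Continuous φ) (hφc : HasCompactSupport φ) :
    IntegrableOn (covarianceDensity σ r τ ψ φ f) (Set.univ ×ˢ brillouin d) := by
  have hpos : (0 : ℝ) < (2 * Real.pi) ^ d := by positivity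
  have hB : MeasurableSet ((Set.univ : Set (Space d)) ×ˢ brillouin d) :=
    MeasurableSet.univ.prod measurableSet_brillouin
  have hfm := aestronglyMeasurable_of_tendsto_wigner hgs hg hf
  have hm : AEStronglyMeasurable (covarianceDensity σ r τ ψ φ f)
      (volume.restrict (Set.univ ×ˢ brillouin d)) := by
    unfold covarianceDensity
    simp only [expPosition_eq r τ hψ hψc, Complex.ofReal_mul]
    refine (((hψ.continuous.comp hr).mul (hφ.comp continuous_fst)).aestronglyMeasurable.mul
      hfm).mul ?_
    exact aestronglyMeasurable_const.add ((hfm.const_mul _).const_mul _)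
  obtain ⟨Cψ, hCψ⟩ := hψc.exists_bound_of_continuous hψ.continuous
  obtain ⟨Cφ, hCφ⟩ := hφc.exists_bound_of_continuous hφ
  set C : ℝ := ∑' n, g n
  have hsign : ‖σ.sign‖ = 1 := by cases σ <;> simp [Statistics.sign]
  set S : Set (Space d × Space d) := tsupport φ ×ˢ brillouin d
  have hS : IsCompact S := hφc.isCompact.prod isCompact_brillouin
  have hSsub : S ⊆ Set.univ ×ˢ brillouin d := Set.prod_mono (Set.subset_univ _) subset_rfl
  have hSm : MeasurableSet S := (isClosed_tsupport φ).measurableSet.prod measurableSet_brillouin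
  have hint : IntegrableOn (covarianceDensity σ r τ ψ φ f) S := by
    have hfin : IsFiniteMeasure (volume.restrict S) := ⟨by simpa using hS.measure_lt_top⟩
    refine Integrable.of_bound (hm.mono_measure (Measure.restrict_mono hSsub le_rfl))
      (Cψ * Cφ * (((2 * Real.pi) ^ d)⁻¹ * C) * (1 + C)) ?_
    filter_upwards [ae_restrict_mem hSm] with p hp
    have h1 := norm_le_of_tendsto_wigner hgs hg hf p.1 hp.2
    have h2 : ‖(f p.1 p.2 : ℂ)‖ ≤ ((2 * Real.pi) ^ d)⁻¹ * C := by
      rw [inv_mul_eq_div, le_div_iff₀ hpos, mul_comm]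
      rwa [Complex.ofReal_mul, norm_mul, Complex.norm_real, Real.norm_of_nonneg hpos.le] at h1
    rw [covarianceDensity, expPosition_eq r τ hψ hψc, norm_mul, norm_mul, norm_mul]
    have hψ0 := (norm_nonneg _).trans (hCψ 0)
    have hφ0 := (norm_nonneg _).trans (hCφ 0)
    have hC0 := (norm_nonneg _).trans h1
    have h3 : ‖1 + σ.sign * (((2 * Real.pi) ^ d * f p.1 p.2 : ℝ) : ℂ)‖ ≤ 1 + C := by
      refine (norm_add_le _ _).trans ?_
      rw [norm_one, norm_mul, hsign, one_mul]
      exact add_le_add_right h1 1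
    gcongr
    · exact hCψ _
    · exact hCφ _
  refine hint.of_forall_sdiff_eq_zero hB fun p hp => ?_
  have h0 : φ p.1 = 0 := image_eq_zero_of_notMem_tsupport fun h => hp.2 ⟨h, hp.1.2⟩
  rw [covarianceDensity, h0, mul_zero, zero_mul, zero_mul]

end Covariance

end QuasiFree

end

/-! ### The limiting covariance -/

open QuasiFree

theorem proposition3 {d : ℕ} (σ : Statistics)
    (h : Space d → LatticePoint d → ℂ)
    (h_herm : ∀ r v, h r (-v) = starRingEnd ℂ (h r v))
    (h_sum : ∀ r, Summable fun v => ‖h r v‖)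
    (h_smooth : ContDiff ℝ 1 fun p : Space d × Space d => energy h p.1 p.2)
    (H : ℝ → selfAdjoint (OneParticle d →L[ℂ] OneParticle d))
    (hH : IsHamiltonian h H)
    (r κ : ℝ → Space d → Space d → Space d)
    (hflow : IsHamiltonFlow (energy h) r κ)
    (D : Submodule ℂ (OneParticle d)) (hD : Dense (D : Set (OneParticle d)))
    (hpos : PositionConverges D H r)
    (ω : ℝ → FieldAlgebra σ (OneParticle d) →ₗ[ℂ] ℂ)
    (hω : ∀ ε > 0, IsQuasiFreeState σ (ω ε))
    (hcluster : Clusters ω H)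
    (f : ℝ → Space d → Space d → ℝ)
    (hf : ∀ (t : ℝ) (x : Space d), ∀ k ∈ brillouin d,
      Tendsto (fun ε => wigner (ω ε) (H ε) ε t x k) (𝓝[>] 0) (𝓝 (f t x k : ℂ)))
    (ψ φ : Space d → ℂ)
    (hψ : ContDiff ℝ (⊤ : ℕ∞) ψ) (hψc : HasCompactSupport ψ)
    (hφ : ContDiff ℝ (⊤ : ℕ∞) φ) (hφc : HasCompactSupport φ)
    (t s : ℝ) :
    IntegrableOn (covarianceDensity σ r (t - s) ψ φ (f s)) (Set.univ ×ˢ brillouin d) ∧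
    Tendsto (fun ε => ω ε (fluctuation (ω ε) (H ε) ε ψ t * fluctuation (ω ε) (H ε) ε φ s))
      (𝓝[>] 0)
      (𝓝 (∫ p in Set.univ ×ˢ brillouin d, covarianceDensity σ r (t - s) ψ φ (f s) p)) := by
  obtain ⟨g, hgs, hg⟩ := hcluster s
  have hgood : ∀ᶠ ε in 𝓝[>] (0 : ℝ), 0 < ε ∧
      ∀ x η : LatticePoint d, ‖twoPoint (ω ε) (H ε) (s / ε) (x + η) x‖ ≤ g η :=
    eventually_mem_nhdsWithin.and hg
  -- Positivity and the clustering bound hold only for small `ε`; dropping an initial segment makes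
  -- them hold at every index.
  have htail : ∀ e : ℕ → ℝ, Tendsto e atTop (𝓝[>] 0) → ∃ N, ∀ i, 0 < e (i + N) ∧
      ∀ x η : LatticePoint d,
        ‖twoPoint (ω (e (i + N))) (H (e (i + N))) (s / e (i + N)) (x + η) x‖ ≤ g η := fun e he => by
    obtain ⟨N, hN⟩ := eventually_atTop.1 (he.eventually hgood)
    exact ⟨N, fun i => hN _ (Nat.le_add_left N i)⟩
  have hint : IntegrableOn (covarianceDensity σ r (t - s) ψ φ (f s)) (Set.univ ×ˢ brillouin d) := by
    obtain ⟨e, he⟩ := exists_seq_tendsto (𝓝[>] (0 : ℝ))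
    obtain ⟨N, hN⟩ := htail e he
    exact integrableOn_covarianceDensity hgs (fun i => (hN i).2)
      (fun x k hk => (hf s x k hk).comp (he.comp (tendsto_add_atTop_nat N)))
      (hflow.position_continuous (t - s)) hψ hψc hφ.continuous hφc
  refine ⟨hint, ?_⟩
  obtain ⟨Cψ, hCψ⟩ := hψc.exists_bound_of_continuous hψ.continuous
  set F : BoundedContinuousFunction (Space d) ℂ :=
    BoundedContinuousFunction.ofNormedAddCommGroup ψ hψ.continuous Cψ hCψ
  have hr : ∀ x, Continuous (r (t - s) x) := fun x =>
    (hflow.position_continuous (t - s)).comp (Continuous.prodMk_right x)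
  -- Fubini separates `x` from `k`; the factor `(2π)^d` attached to the first `f` is compensated by
  -- the normalisation of `brillouinMeasure`.
  have hlimit : (∫ p in Set.univ ×ˢ brillouin d, covarianceDensity σ r (t - s) ψ φ (f s) p) =
      ∫ x, φ x * ∫ k, F (r (t - s) x k) * (((2 * Real.pi) ^ d * f s x k : ℝ) : ℂ) *
        (1 + σ.sign * (((2 * Real.pi) ^ d * f s x k : ℝ) : ℂ)) ∂brillouinMeasure d := by
    have hprod := setIntegral_prod (covarianceDensity σ r (t - s) ψ φ (f s))
      (μ := (volume : Measure (Space d))) (ν := (volume : Measure (Space d))) hint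
    refine hprod.trans ?_
    rw [Measure.restrict_univ]
    refine integral_congr_ae (Eventually.of_forall fun x => ?_)
    have hne : (((2 * Real.pi) ^ d : ℝ) : ℂ) ≠ 0 := by
      exact_mod_cast (by positivity : ((2 * Real.pi) ^ d : ℝ) ≠ 0)
    simp only [integral_brillouinMeasure]
    rw [← integral_const_mul, ← integral_const_mul]
    refine integral_congr_ae (Eventually.of_forall fun k => ?_)
    simp only [covarianceDensity, expPosition_eq r (t - s) hψ hψc]
    change ψ (r (t - s) x k) * φ x * (f s x k : ℂ) * _ = φ x * (_ * (ψ (r (t - s) x k) * _ * _))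
    rw [Complex.ofReal_mul]
    field_simp
  rw [hlimit]
  -- Almost everywhere convergence is available only along subsequences. This is enough, since the
  -- limit does not depend on the subsequence.
  refine tendsto_of_subseq_tendsto fun ns hns => ?_
  obtain ⟨N, hN⟩ := htail ns hns
  have hns' : Tendsto (fun i => ns (i + N)) atTop (𝓝[>] 0) := hns.comp (tendsto_add_atTop_nat N)
  obtain ⟨ms, hms⟩ := exists_subseq_tendsto_covariance (e := fun i => ns (i + N))
    (ω := fun i => ω (ns (i + N))) (H := fun i => H (ns (i + N))) (fun i => (hN i).1)
    (hns'.mono_right nhdsWithin_le_nhds) (fun i => hω _ (hN i).1) hgs (fun i => (hN i).2)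
    (fun x k hk => (hf s x k hk).comp hns') t F hψc (fun x => ⟨r (t - s) x, hr x⟩)
    (fun x u => (tendsto_heisenberg hD hpos (t - s) x (hr x) F hψc u).comp hns')
    hφ.continuous hφc
  exact ⟨fun i => ms i + N, hms⟩
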